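/- Let either $0<b<\infty$ or $b=\infty$, and let $q:(0,b)\to\mathbb R$ belong to one of the following cases. (1) $b<\infty$ and $q\in L^1((0,b))$; fix $h\in\mathbb R\cup\{\infty\}$ and consider the condition $u'(b_-)+h\,u(b_-)=0$ (for $h=\infty$: $u(b_-)=0$). For (2)–(4), $b=\infty$ and $\int_0^a|q(x)|\,dx<\infty$ for all $a<\infty$. (2) $\sup_{a>0}\int_a^{a+1}\max(-q(x),0)\,dx<\infty$; consider the condition that $u$ be $L^2$ near $\infty$. (3) $-\frac{d^2}{dx^2}+q$ is limit point at $\infty$, that is, for each $z$ with $\operatorname{Im} z>0$ the equation $-u''+qu=zu$ has, up to a multiplicative constant, exactly one nonzero solution that is $L^2$ near $\infty$; consider again the condition that $u$ be $L^2$ near $\infty$. (4) $-\frac{d^2}{dx^2}+q$ is limit circle at $\infty$, that is, for each $z$ with $\operatorname{Im} z>0$ every solution of $-u''+qu=zu$ is $L^2$ near $\infty$; fix a nonzero solution $u_0$ of $-u_0''+qu_0=iu_0$ that defines a self-adjoint boundary condition, i.e. $\lim_{x\to\infty}[u_0(x)\overline{u_0'(x)}-u_0'(x)\overline{u_0(x)}]=0$,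 and consider the condition $\lim_{x\to\infty}[u_0(x)u'(x)-u_0'(x)u(x)]=0$. Here solutions are functions $u$ with $u,u'$ locally absolutely continuous on $[0,b)$ that satisfy the equation almost everywhere. For $\operatorname{Im} z>0$ let $m(z)=u'(0_+)/u(0_+)$ be the Weyl–Titchmarsh $m$-function, where $u$ is a nonzero solution of $-u''+qu=zu$ on $[0,b)$ that satisfies the condition under consideration. Then there exists a function $A:[0,b)\to\mathbb R$ with $A\in L^1((0,a))$ for all $0<a<b$ such that, for all $0<a<b$ and all $\varepsilon>0$, $$m(-\kappa^2)=-\kappa-\int_0^a A(\alpha)e^{-2\alpha\kappa}\,d\alpha+\tilde O(e^{-2a\kappa})$$ as $|\kappa|\to\infty$ with $-\frac{\pi}{2}+\varepsilon<\arg\kappa<-\varepsilon$. Here $f=\tilde O(g)$ means that $g\to0$ and that $(f/g)|g|^{\delta}\to0$ for every $\delta>0$, as $|\kappa|\to\infty$ in the sector. Moreover, $A-q$ is continuous on $[0,b)$ and, for all $\alpha\in[0,b)$, $$|(A-q)(\alpha)|\le\Big[\int_0^\alpha|q(x)|\,dx\Big]^2\exp\Big(\alpha\int_0^\alpha|q(x)|\,dx\Big).$$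 -/

import Mathlib

open MeasureTheory Filter Topology Set

noncomputable section

namespace HalfLine

/-- The pair `(u, v)`, with `v = u'`, is a (Carathéodory) solution of `-u'' + q u = z u` on `[0, b)`:
both functions are continuous, `u' = v` and `v' = (q - z) u` in integrated form. Thus `u` and `u'`
are locally absolutely continuous on `[0, b)`, and `u (0+) = u 0`, `u' (0+) = v 0`. -/
structure IsSolution (q : ℝ → ℝ) (b : EReal) (z : ℂ) (u v : ℝ → ℂ) : Prop where
  continuousOn_fst : ContinuousOn u {x : ℝ | 0 ≤ x ∧ (x : EReal) < b}
  continuousOn_snd : ContinuousOn v {x : ℝ | 0 ≤ x ∧ (x : EReal) < b}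
  fst_eq : ∀ x : ℝ, 0 ≤ x → (x : EReal) < b → u x = u 0 + ∫ t in (0 : ℝ)..x, v t
  snd_eq : ∀ x : ℝ, 0 ≤ x → (x : EReal) < b →
    v x = v 0 + ∫ t in (0 : ℝ)..x, ((q t : ℂ) - z) * u t

/-- `u` does not vanish identically on `[0, b)`. -/
def IsNonzero (b : EReal) (u : ℝ → ℂ) : Prop :=
  ∃ x : ℝ, 0 ≤ x ∧ (x : EReal) < b ∧ u x ≠ 0

/-- `u` is square integrable near `∞`. -/
def IsL2AtTop (u : ℝ → ℂ) : Prop :=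
  ∃ R : ℝ, 0 ≤ R ∧ IntegrableOn (fun x => ‖u x‖ ^ 2) (Ioi R)

/-- `q` is integrable on every `(0, a)`, `a < ∞`. -/
def IsLocallyL1 (q : ℝ → ℝ) : Prop :=
  ∀ a : ℝ, 0 < a → IntegrableOn q (Ioo 0 a)

/-- `sup_{a > 0} ∫_a^{a+1} max (-q) 0 < ∞`. -/
def IsEssBddBelow (q : ℝ → ℝ) : Prop :=
  ∃ C : ℝ, ∀ a : ℝ, 0 < a → ∫ x in a..(a + 1), max (-q x) 0 ≤ C

/-- Limit point at `∞`: for each `z` in the open upper half-plane there is, up to a multiplicative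
constant, exactly one nonzero solution that is square integrable near `∞`. -/
def IsLimitPoint (q : ℝ → ℝ) : Prop :=
  ∀ z : ℂ, 0 < z.im → ∃ u v : ℝ → ℂ, IsSolution q ⊤ z u v ∧ IsNonzero ⊤ u ∧ IsL2AtTop u ∧
    ∀ u₁ v₁ : ℝ → ℂ, IsSolution q ⊤ z u₁ v₁ → IsL2AtTop u₁ →
      ∃ c : ℂ, ∀ x : ℝ, 0 ≤ x → u₁ x = c * u x

/-- Limit circle at `∞`: for each `z` in the open upper half-plane every solution is square
integrable near `∞`. -/
def IsLimitCircle (q : ℝ → ℝ) : Prop :=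
  ∀ z : ℂ, 0 < z.im → ∀ u v : ℝ → ℂ, IsSolution q ⊤ z u v → IsL2AtTop u

/-- The right endpoint together with the condition imposed there:
* `finite b h`: the endpoint is `b < ∞` and the condition is `u'(b-) + h u(b-) = 0`, where
  `h = ∞` stands for `u(b-) = 0`;
* `squareIntegrable`: the endpoint is `∞` and `u` has to be square integrable near `∞`;
* `limitCircle u₀ v₀`: the endpoint is `∞` and the Wronskian of `u₀` (with derivative `v₀`) and `u`
  has to vanish at `∞`. -/
inductive EndCondition where
  | finite (b : ℝ) (h : OnePoint ℝ)
  | squareIntegrable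
  | limitCircle (u₀ v₀ : ℝ → ℂ)

namespace EndCondition

/-- The right endpoint. -/
def endpoint : EndCondition → EReal
  | finite b _ => (b : EReal)
  | squareIntegrable => ⊤
  | limitCircle _ _ => ⊤

/-- The function `u` with derivative `v` satisfies the condition at the right endpoint. -/
def Holds : EndCondition → (ℝ → ℂ) → (ℝ → ℂ) → Prop
  | finite b (some h), u, v => Tendsto (fun x => v x + (h : ℂ) * u x) (𝓝[<] b) (𝓝 0)
  | finite b none, u, _ => Tendsto u (𝓝[<] b) (𝓝 0)
  | squareIntegrable, u, _ => IsL2AtTop u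
  | limitCircle u₀ v₀, u, v => Tendsto (fun x => u₀ x * v x - v₀ x * u x) atTop (𝓝 0)

/-- The potential `q` and the condition at the right endpoint fit together. In the limit circle case
`u₀` is a nonzero solution for `z = i` that defines a self-adjoint boundary condition, that is,
the Wronskian of `u₀` and its complex conjugate vanishes at `∞`. -/
def Admissible (q : ℝ → ℝ) : EndCondition → Prop
  | finite b _ => 0 < b ∧ IntegrableOn q (Ioo 0 b)
  | squareIntegrable => IsLocallyL1 q ∧ (IsEssBddBelow q ∨ IsLimitPoint q)
  | limitCircle u₀ v₀ => IsLocallyL1 q ∧ IsLimitCircle q ∧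
      IsSolution q ⊤ Complex.I u₀ v₀ ∧ IsNonzero ⊤ u₀ ∧
      Tendsto (fun x => u₀ x * star (v₀ x) - v₀ x * star (u₀ x)) atTop (𝓝 0)

end EndCondition

/-- `p = (u, u')` is a nonzero solution of `-u'' + q u = z u` that satisfies the condition at the
right endpoint. -/
def IsWeylSolution (q : ℝ → ℝ) (e : EndCondition) (z : ℂ) (p : (ℝ → ℂ) × (ℝ → ℂ)) : Prop :=
  IsSolution q e.endpoint z p.1 p.2 ∧ IsNonzero e.endpoint p.1 ∧ e.Holds p.1 p.2

open Classical in
/-- The Weyl-Titchmarsh function `m z = u'(0+) / u(0+)`, for a nonzero solution `u` that satisfies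
the condition at the right endpoint (with the value `0` if there is no such solution). -/
def weylM (q : ℝ → ℝ) (e : EndCondition) (z : ℂ) : ℂ :=
  if h : ∃ p, IsWeylSolution q e z p then h.choose.2 0 / h.choose.1 0 else 0

/-- The filter of `|κ| → ∞` with `-π/2 + ε < arg κ < -ε`. -/
def sectorAtInfinity (ε : ℝ) : Filter ℂ :=
  comap (fun κ : ℂ => ‖κ‖) atTop ⊓ 𝓟 {κ : ℂ | -(Real.pi / 2) + ε < κ.arg ∧ κ.arg < -ε}

/-- `f = Õ(g)` along `l`: `g → 0` and `(f / g) |g| ^ ε → 0` for all `ε > 0`. -/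
def IsOTilde (l : Filter ℂ) (f g : ℂ → ℂ) : Prop :=
  Tendsto g l (𝓝 0) ∧
    ∀ ε : ℝ, 0 < ε → Tendsto (fun κ => f κ / g κ * ((‖g κ‖ ^ ε : ℝ) : ℂ)) l (𝓝 0)

end HalfLine

end

/-!
On `[0, a]` the quotient `u' / u` of a Weyl solution depends on `q` beyond `a` only up to an
exponentially small error. Indeed, the flux `Im (u' ū)` is nonnegative in each of the four cases,
and this alone forces `u' + κ u = O(u)` on `[0, a]` uniformly in the sector. Comparing `u`, through
the Wronskian, with the Jost solution of `q` cut off at `a`, both of size `e^(-κ a)` at `a`, bounds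
the difference of their logarithmic derivatives at `0` by a multiple of `e^(-2 κ a)`. For an
integrable potential, `e^(κ x)` times the Jost solution is `1` plus the Laplace transform of a
transformation kernel, built by successive approximation, and dividing in the convolution algebra
turns its logarithmic derivative at `0` into `-κ` minus the Laplace transform of the `A`-function.
-/

namespace HalfLine

section Primitive

variable {E G : Type*} [NormedAddCommGroup E] [NormedSpace ℝ E] [NormedAddCommGroup G]
  [NormedSpace ℝ G] {F F₁ F₂ f f₁ f₂ : ℝ → E} {a b x y : ℝ}

/-- `F` is absolutely continuous on the interval with endpoints `a` and `b`, with derivative `f`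
almost everywhere. This is encoded through the fundamental theorem of calculus. -/
structure IsPrimitiveOn (F f : ℝ → E) (a b : ℝ) : Prop where
  intervalIntegrable : IntervalIntegrable f volume a b
  sub_eq : ∀ ⦃x⦄, x ∈ uIcc a b → ∀ ⦃y⦄, y ∈ uIcc a b → F y - F x = ∫ t in x..y, f t

theorem absolutelyContinuousOnInterval_of_dist_le {X Y : Type*} [PseudoMetricSpace X]
    [PseudoMetricSpace Y] {g : ℝ → X} {h : ℝ → Y} (hh : AbsolutelyContinuousOnInterval h a b)
    (hgh : ∀ x ∈ uIcc a b, ∀ y ∈ uIcc a b, dist (g x) (g y) ≤ dist (h x) (h y)) :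
    AbsolutelyContinuousOnInterval g a b := by
  refine squeeze_zero' (Eventually.of_forall fun I => Finset.sum_nonneg fun _ _ => dist_nonneg)
    ?_ hh
  filter_upwards [mem_inf_of_right (mem_principal_self _)] with I hI
  exact Finset.sum_le_sum fun i hi => hgh _ (hI.1 i hi).1 _ (hI.1 i hi).2

namespace IsPrimitiveOn

theorem of_eq_add (hf : IntervalIntegrable f volume a b)
    (hF : ∀ x ∈ uIcc a b, F x = F a + ∫ t in a..x, f t) : IsPrimitiveOn F f a b where
  intervalIntegrable := hf
  sub_eq x hx y hy := by
    have hint {x} (hx : x ∈ uIcc a b) : IntervalIntegrable f volume a x :=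
      hf.mono_set (uIcc_subset_uIcc_left hx)
    rw [hF x hx, hF y hy, add_sub_add_left_eq_sub,
      intervalIntegral.integral_interval_sub_left (hint hy) (hint hx)]

theorem eq_add (h : IsPrimitiveOn F f a b) (hx : x ∈ uIcc a b) :
    F x = F a + ∫ t in a..x, f t := by
  rw [← h.sub_eq left_mem_uIcc hx, add_sub_cancel]

theorem mono (h : IsPrimitiveOn F f a b) (hx : x ∈ uIcc a b) (hy : y ∈ uIcc a b) :
    IsPrimitiveOn F f x y where
  intervalIntegrable := h.intervalIntegrable.mono_set (uIcc_subset_uIcc hx hy)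
  sub_eq _ hs _ ht := h.sub_eq (uIcc_subset_uIcc hx hy hs) (uIcc_subset_uIcc hx hy ht)

theorem congr_left (h : IsPrimitiveOn F₁ f a b) (hF : ∀ x ∈ uIcc a b, F₂ x = F₁ x) :
    IsPrimitiveOn F₂ f a b where
  intervalIntegrable := h.intervalIntegrable
  sub_eq x hx y hy := by rw [hF x hx, hF y hy, h.sub_eq hx hy]

theorem congr_right (h : IsPrimitiveOn F f₁ a b) (hf : ∀ x ∈ uIcc a b, f₁ x = f₂ x) :
    IsPrimitiveOn F f₂ a b where
  intervalIntegrable := h.intervalIntegrable.congr fun x hx => hf x (uIoc_subset_uIcc hx)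
  sub_eq x hx y hy := by
    rw [h.sub_eq hx hy]
    exact intervalIntegral.integral_congr fun t ht => hf t (uIcc_subset_uIcc hx hy ht)

theorem add (h₁ : IsPrimitiveOn F₁ f₁ a b) (h₂ : IsPrimitiveOn F₂ f₂ a b) :
    IsPrimitiveOn (fun x => F₁ x + F₂ x) (fun x => f₁ x + f₂ x) a b where
  intervalIntegrable := h₁.intervalIntegrable.add h₂.intervalIntegrable
  sub_eq x hx y hy := by
    rw [intervalIntegral.integral_add (h₁.mono hx hy).intervalIntegrable
      (h₂.mono hx hy).intervalIntegrable, ← h₁.sub_eq hx hy, ← h₂.sub_eq hx hy]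
    abel

theorem clm_comp [CompleteSpace E] [CompleteSpace G] (h : IsPrimitiveOn F f a b) (L : E →L[ℝ] G) :
    IsPrimitiveOn (fun x => L (F x)) (fun x => L (f x)) a b where
  intervalIntegrable := ⟨L.integrable_comp h.intervalIntegrable.1,
    L.integrable_comp h.intervalIntegrable.2⟩
  sub_eq x hx y hy := by
    rw [L.intervalIntegral_comp_comm (h.mono hx hy).intervalIntegrable, ← h.sub_eq hx hy, map_sub]

theorem sub (h₁ : IsPrimitiveOn F₁ f₁ a b) (h₂ : IsPrimitiveOn F₂ f₂ a b) :
    IsPrimitiveOn (fun x => F₁ x - F₂ x) (fun x => f₁ x - f₂ x) a b where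
  intervalIntegrable := h₁.intervalIntegrable.sub h₂.intervalIntegrable
  sub_eq x hx y hy := by
    rw [intervalIntegral.integral_sub (h₁.mono hx hy).intervalIntegrable
      (h₂.mono hx hy).intervalIntegrable, ← h₁.sub_eq hx hy, ← h₂.sub_eq hx hy]
    abel

theorem absolutelyContinuousOnInterval (h : IsPrimitiveOn F f a b) :
    AbsolutelyContinuousOnInterval F a b := by
  refine absolutelyContinuousOnInterval_of_dist_le
    (h.intervalIntegrable.norm.absolutelyContinuousOnInterval_intervalIntegral left_mem_uIcc)
    fun x hx y hy => ?_
  have hint {x} (hx : x ∈ uIcc a b) : IntervalIntegrable (fun t => ‖f t‖) volume a x :=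
    (h.mono left_mem_uIcc hx).intervalIntegrable.norm
  rw [dist_comm, dist_comm (∫ t in a..x, ‖f t‖), dist_eq_norm, h.sub_eq hx hy, Real.dist_eq,
    intervalIntegral.integral_interval_sub_left (hint hy) (hint hx)]
  exact intervalIntegral.norm_integral_le_abs_integral_norm

theorem continuousOn (h : IsPrimitiveOn F f a b) : ContinuousOn F (uIcc a b) :=
  h.absolutelyContinuousOnInterval.continuousOn

theorem ae_hasDerivAt [CompleteSpace E] (h : IsPrimitiveOn F f a b) :
    ∀ᵐ x, x ∈ uIcc a b → HasDerivAt F (f x) x := by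
  filter_upwards [h.intervalIntegrable.ae_hasDerivAt_integral, Measure.ae_ne volume (min a b),
    Measure.ae_ne volume (max a b)] with x hx hxa hxb hxab
  have hnhds : uIcc a b ∈ 𝓝 x := Icc_mem_nhds (hxab.1.lt_of_ne' hxa) (hxab.2.lt_of_ne hxb)
  exact ((hx hxab a left_mem_uIcc).const_add (F a)).congr_of_eventuallyEq
    (eventually_of_mem hnhds fun t ht => h.eq_add ht)

theorem of_ae_hasDerivAt [CompleteSpace E] (hF : AbsolutelyContinuousOnInterval F a b)
    (hf : IntervalIntegrable f volume a b)
    (hFf : ∀ᵐ x, x ∈ uIcc a b → HasDerivAt F (f x) x) : IsPrimitiveOn F f a b := by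
  have hI : IsPrimitiveOn (fun x => ∫ t in a..x, f t) f a b := .of_eq_add hf fun x _ => by simp
  obtain ⟨c, hc⟩ := (hF.sub hI.absolutelyContinuousOnInterval).const_of_ae_hasDerivAt_zero (by
    filter_upwards [hFf, hI.ae_hasDerivAt] with x hx hIx hxab
    simpa only [sub_self] using (hx hxab).sub (hIx hxab))
  refine .of_eq_add hf fun x hx => ?_
  have ha := hc a left_mem_uIcc
  rw [Pi.sub_apply, intervalIntegral.integral_same, sub_zero] at ha
  rw [ha, ← hc x hx, Pi.sub_apply, sub_add_cancel]

theorem of_hasDerivAt [CompleteSpace E] (h : ∀ x, HasDerivAt F (f x) x) (hf : Continuous f) :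
    IsPrimitiveOn F f a b where
  intervalIntegrable := hf.intervalIntegrable _ _
  sub_eq _ _ _ _ := (intervalIntegral.integral_eq_sub_of_hasDerivAt (fun t _ => h t)
    (hf.intervalIntegrable _ _)).symm

section Field

variable {𝕜 : Type*} [RCLike 𝕜] {F G f g : ℝ → 𝕜}

theorem mul (hF : IsPrimitiveOn F f a b) (hG : IsPrimitiveOn G g a b) :
    IsPrimitiveOn (fun x => F x * G x) (fun x => f x * G x + F x * g x) a b := by
  refine .of_ae_hasDerivAt
    (hF.absolutelyContinuousOnInterval.fun_smul hG.absolutelyContinuousOnInterval)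
    ((hF.intervalIntegrable.mul_continuousOn hG.continuousOn).add
      (hG.intervalIntegrable.continuousOn_mul hF.continuousOn)) ?_
  filter_upwards [hF.ae_hasDerivAt, hG.ae_hasDerivAt] with x hFx hGx hx
  exact (hFx hx).mul (hGx hx)

theorem const_mul (c : 𝕜) (hF : IsPrimitiveOn F f a b) :
    IsPrimitiveOn (fun x => c * F x) (fun x => c * f x) a b where
  intervalIntegrable := hF.intervalIntegrable.const_mul c
  sub_eq x hx y hy := by
    rw [intervalIntegral.integral_const_mul, ← hF.sub_eq hx hy, mul_sub]

theorem pow_succ (hF : IsPrimitiveOn F f a b) (n : ℕ) :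
    IsPrimitiveOn (fun x => F x ^ (n + 1)) (fun x => (n + 1) * (f x * F x ^ n)) a b := by
  induction n with
  | zero => simpa using hF
  | succ n ih =>
    simp only [_root_.pow_succ _ (n + 1)]
    refine (ih.mul hF).congr_right fun x _ => ?_
    push_cast
    ring

end Field

theorem exp_mul {F f : ℝ → ℂ} (hF : IsPrimitiveOn F f a b) (c : ℂ) :
    IsPrimitiveOn (fun x => Complex.exp (c * x) * F x)
      (fun x => Complex.exp (c * x) * (c * F x + f x)) a b := by
  have hexp : IsPrimitiveOn (fun x : ℝ => Complex.exp (c * x)) (fun x => Complex.exp (c * x) * c)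
      a b :=
    .of_hasDerivAt (fun x => by
      simpa using ((Complex.ofRealCLM.hasDerivAt (x := x)).const_mul c).cexp) (by fun_prop)
  exact (hexp.mul hF).congr_right fun x _ => by ring

end IsPrimitiveOn

theorem integral_mul_integral_pow {p : ℝ → ℝ} (hp : IntervalIntegrable p volume a b) (n : ℕ) :
    ∫ t in a..b, p t * (∫ s in a..t, p s) ^ n = (∫ s in a..b, p s) ^ (n + 1) / (n + 1) := by
  have hP : IsPrimitiveOn (fun x => ∫ s in a..x, p s) p a b := .of_eq_add hp fun x _ => by simp
  have hpow := (hP.pow_succ n).sub_eq left_mem_uIcc right_mem_uIcc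
  rw [intervalIntegral.integral_same, zero_pow n.succ_ne_zero, sub_zero,
    intervalIntegral.integral_const_mul] at hpow
  rw [hpow, mul_div_cancel_left₀ _ (by positivity)]

end Primitive

section LinearODE

variable {E : Type*} [NormedAddCommGroup E] [NormedSpace ℝ E] {A : ℝ → E →L[ℝ] E}

/-- The terms of the Picard series of the solution of `u' = A u`, `u 0 = w`. -/
noncomputable def picardTerm (A : ℝ → E →L[ℝ] E) (w : E) : ℕ → ℝ → E
  | 0 => fun _ => w
  | n + 1 => fun x => ∫ t in (0 : ℝ)..x, A t (picardTerm A w n t)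

theorem intervalIntegrable_clm_apply {u : ℝ → E} {x y : ℝ} (hA : IntervalIntegrable A volume x y)
    (hu : ContinuousOn u (uIcc x y)) : IntervalIntegrable (fun t => A t (u t)) volume x y := by
  obtain ⟨C, hC⟩ := isCompact_uIcc.exists_bound_of_continuousOn hu
  have hu' : AEStronglyMeasurable u (volume.restrict (uIoc x y)) :=
    (hu.mono uIoc_subset_uIcc).aestronglyMeasurable measurableSet_uIoc
  refine (hA.norm.mul_const C).mono_fun
    ((ContinuousLinearMap.id ℝ (E →L[ℝ] E)).aestronglyMeasurable_comp₂
      hA.aestronglyMeasurable_restrict_uIoc hu') ?_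
  filter_upwards [ae_restrict_mem measurableSet_uIoc] with t ht
  exact ((A t).le_opNorm_of_le (hC t (uIoc_subset_uIcc ht))).trans (le_abs_self _)

theorem continuous_picardTerm (hA : ∀ x y, IntervalIntegrable A volume x y) (w : E) (n : ℕ) :
    Continuous (picardTerm A w n) := by
  induction n with
  | zero => exact continuous_const
  | succ n ih =>
    exact intervalIntegral.continuous_primitive
      (fun x y => intervalIntegrable_clm_apply (hA x y) ih.continuousOn) 0

theorem norm_picardTerm_le (hA : ∀ x y, IntervalIntegrable A volume x y) (w : E) (n : ℕ) {x : ℝ}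
    (hx : 0 ≤ x) :
    ‖picardTerm A w n x‖ ≤ ‖w‖ * ((∫ t in (0 : ℝ)..x, ‖A t‖) ^ n / n.factorial) := by
  induction n generalizing x with
  | zero => simp [picardTerm]
  | succ n ih =>
    have hcont : Continuous fun x => ∫ t in (0 : ℝ)..x, ‖A t‖ :=
      intervalIntegral.continuous_primitive (fun x y => (hA x y).norm) 0
    calc ‖∫ t in (0 : ℝ)..x, A t (picardTerm A w n t)‖
        ≤ ∫ t in (0 : ℝ)..x, ‖A t‖ * (‖w‖ * ((∫ s in (0 : ℝ)..t, ‖A s‖) ^ n / n.factorial)) := by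
          refine intervalIntegral.norm_integral_le_of_norm_le hx (ae_of_all _ fun t ht => ?_)
            ((hA 0 x).norm.mul_continuousOn (by fun_prop))
          exact (A t).le_opNorm_of_le (ih ht.1.le)
      _ = ‖w‖ / n.factorial * ∫ t in (0 : ℝ)..x, ‖A t‖ * (∫ s in (0 : ℝ)..t, ‖A s‖) ^ n := by
          rw [← intervalIntegral.integral_const_mul]
          congr 1
          ext t
          ring
      _ = ‖w‖ * ((∫ t in (0 : ℝ)..x, ‖A t‖) ^ (n + 1) / (n + 1).factorial) := by
          rw [integral_mul_integral_pow (hA 0 x).norm, Nat.factorial_succ]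
          push_cast
          field_simp

theorem exists_eq_add_integral_clm [CompleteSpace E] (hA : ∀ x y, IntervalIntegrable A volume x y)
    (w : E) :
    ∃ u : ℝ → E, ContinuousOn u (Ici 0) ∧ ∀ x, 0 ≤ x → u x = w + ∫ t in (0 : ℝ)..x, A t (u t) := by
  let c (X : ℝ) (n : ℕ) : ℝ := ‖w‖ * ((∫ t in (0 : ℝ)..X, ‖A t‖) ^ n / n.factorial)
  have hc (X : ℝ) : Summable (c X) := (Real.summable_pow_div_factorial _).mul_left _
  have hbound {X x : ℝ} (hx : x ∈ Icc 0 X) (n : ℕ) : ‖picardTerm A w n x‖ ≤ c X n := by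
    have hmono : ∫ t in (0 : ℝ)..x, ‖A t‖ ≤ ∫ t in (0 : ℝ)..X, ‖A t‖ :=
      intervalIntegral.integral_mono_interval le_rfl hx.1 hx.2
        (ae_of_all _ fun t => norm_nonneg _) (hA 0 X).norm
    have hnonneg : 0 ≤ ∫ t in (0 : ℝ)..x, ‖A t‖ :=
      intervalIntegral.integral_nonneg hx.1 fun t _ => norm_nonneg _
    refine (norm_picardTerm_le hA w n hx.1).trans ?_
    simp only [c]
    gcongr
  have hcont := continuous_picardTerm hA w
  have hsum {x : ℝ} (hx : 0 ≤ x) :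
      HasSum (fun n => picardTerm A w n x) (∑' n, picardTerm A w n x) :=
    (Summable.of_norm_bounded (hc x) (hbound ⟨hx, le_rfl⟩)).hasSum
  have hstep {x : ℝ} (hx : 0 ≤ x) : HasSum (fun n => picardTerm A w (n + 1) x)
      (∫ t in (0 : ℝ)..x, A t (∑' n, picardTerm A w n t)) := by
    have hmem {t : ℝ} (ht : t ∈ uIoc 0 x) : t ∈ Icc 0 x := by
      rw [uIoc_of_le hx] at ht
      exact Ioc_subset_Icc_self ht
    refine intervalIntegral.hasSum_integral_of_dominated_convergence (fun n t => ‖A t‖ * c x n)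
      (fun n => (intervalIntegrable_clm_apply (hA 0 x)
        (hcont n).continuousOn).aestronglyMeasurable_restrict_uIoc)
      (fun n => ae_of_all _ fun t ht => (A t).le_opNorm_of_le (hbound (hmem ht) n))
      (ae_of_all _ fun t _ => (hc x).mul_left _) ?_
      (ae_of_all _ fun t ht => (A t).hasSum (hsum (hmem ht).1))
    simp_rw [tsum_mul_left]
    exact (hA 0 x).norm.mul_const _
  refine ⟨fun x => ∑' n, picardTerm A w n x, fun x hx => ?_, fun x hx =>
    (hsum hx).unique (HasSum.zero_add (f := fun n => picardTerm A w n x) (hstep hx))⟩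
  have hIcc : ContinuousOn (fun x => ∑' n, picardTerm A w n x) (Icc 0 (x + 1)) :=
    continuousOn_tsum (fun n => (hcont n).continuousOn) (hc (x + 1)) fun n t ht => hbound ht n
  refine (hIcc x ⟨hx, by linarith⟩).mono_of_mem_nhdsWithin ?_
  rw [← Ici_inter_Iic]
  exact inter_mem_nhdsWithin _ (Iic_mem_nhds (by linarith))

end LinearODE

section Solutions

variable {q : ℝ → ℝ} {b : EReal} {z : ℂ} {u v u₁ v₁ u₂ v₂ : ℝ → ℂ} {x y X : ℝ}

theorem coe_lt_of_le (hx : x ≤ X) (hX : (X : EReal) < b) : (x : EReal) < b :=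
  (EReal.coe_le_coe_iff.2 hx).trans_lt hX

theorem uIcc_zero_subset (hX : 0 ≤ X) (hXb : (X : EReal) < b) :
    uIcc 0 X ⊆ {x : ℝ | 0 ≤ x ∧ (x : EReal) < b} := by
  rw [uIcc_of_le hX]
  exact fun x hx => ⟨hx.1, coe_lt_of_le hx.2 hXb⟩

theorem intervalIntegrable_ofReal {p : ℝ → ℝ} (hp : IntervalIntegrable p volume x y) :
    IntervalIntegrable (fun t => (p t : ℂ)) volume x y :=
  ⟨hp.1.ofReal, hp.2.ofReal⟩

/-- `q` is integrable on every bounded interval in `(0, b)` that starts at `0`, up to and including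
the endpoint `b` if it is finite. -/
def IsIntegrableUpTo (q : ℝ → ℝ) (b : EReal) : Prop :=
  ∀ X : ℝ, IntegrableOn q {x : ℝ | 0 < x ∧ x < X ∧ (x : EReal) < b}

theorem IsIntegrableUpTo.intervalIntegrable (hq : IsIntegrableUpTo q b) (hX : 0 ≤ X)
    (hXb : (X : EReal) < b) : IntervalIntegrable q volume 0 X := by
  rw [intervalIntegrable_iff_integrableOn_Ioc_of_le hX]
  exact (hq (X + 1)).mono_set fun x hx =>
    ⟨hx.1, hx.2.trans_lt (lt_add_one X), coe_lt_of_le hx.2 hXb⟩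

theorem IsIntegrableUpTo.intervalIntegrable_indicator (hq : IsIntegrableUpTo q b) (x y : ℝ) :
    IntervalIntegrable ({x : ℝ | 0 < x ∧ (x : EReal) < b}.indicator q) volume x y := by
  have hm : MeasurableSet {x : ℝ | 0 < x ∧ (x : EReal) < b} :=
    (measurableSet_lt measurable_const measurable_id).inter
      (measurableSet_lt measurable_coe_real_ereal measurable_const)
  rw [intervalIntegrable_iff, integrableOn_indicator_iff hm]
  exact (hq (max x y + 1)).mono_set fun t ht =>
    ⟨ht.1.1, ht.2.2.trans_lt (lt_add_one _), ht.1.2⟩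

/-- The linear map `(u, u') ↦ (u', (s - z) u)` by which `-u'' + q u = z u` becomes a first order
system at a point where `q` takes the value `s`. -/
noncomputable def systemMatrix (z : ℂ) (s : ℝ) : ℂ × ℂ →L[ℝ] ℂ × ℂ :=
  (ContinuousLinearMap.snd ℝ ℂ ℂ).prod (-(z • ContinuousLinearMap.fst ℝ ℂ ℂ)) +
    s • (0 : ℂ × ℂ →L[ℝ] ℂ).prod (ContinuousLinearMap.fst ℝ ℂ ℂ)

theorem systemMatrix_apply (z : ℂ) (s : ℝ) (w : ℂ × ℂ) :
    systemMatrix z s w = (w.2, ((s : ℂ) - z) * w.1) := by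
  simp only [systemMatrix, add_apply, ContinuousLinearMap.prod_apply, neg_apply, smul_apply,
    ContinuousLinearMap.coe_fst', ContinuousLinearMap.coe_snd', smul_eq_mul, zero_apply,
    Prod.smul_mk, smul_zero, Complex.real_smul, Prod.mk_add_mk, add_zero, Prod.mk.injEq, true_and]
  ring

theorem exists_isSolution (hq : IsIntegrableUpTo q b) (z : ℂ) (w : ℂ × ℂ) :
    ∃ u v : ℝ → ℂ, IsSolution q b z u v ∧ ContinuousOn u (Ici 0) ∧ ContinuousOn v (Ici 0) ∧
      u 0 = w.1 ∧ v 0 = w.2 := by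
  let Q : ℝ → ℝ := {x : ℝ | 0 < x ∧ (x : EReal) < b}.indicator q
  have hA (x y : ℝ) : IntervalIntegrable (fun t => systemMatrix z (Q t)) volume x y :=
    have hQxy := hq.intervalIntegrable_indicator x y
    intervalIntegrable_const.add ⟨hQxy.1.smul_const _, hQxy.2.smul_const _⟩
  obtain ⟨W, hWc, hW⟩ := exists_eq_add_integral_clm hA w
  have hW0 : W 0 = w := by simpa using hW 0 le_rfl
  have hP {x : ℝ} (hx : 0 ≤ x) : IsPrimitiveOn W (fun t => systemMatrix z (Q t) (W t)) 0 x := by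
    have hsub : uIcc 0 x ⊆ Ici 0 := by
      rw [uIcc_of_le hx]
      exact Icc_subset_Ici_self
    exact .of_eq_add (intervalIntegrable_clm_apply (hA 0 x) (hWc.mono hsub)) fun y hy => by
      rw [hW0, hW y (hsub hy)]
  refine ⟨fun x => (W x).1, fun x => (W x).2, ⟨?_, ?_, fun x hx _ => ?_, fun x hx hxb => ?_⟩,
    hWc.fst, hWc.snd, congrArg Prod.fst hW0, congrArg Prod.snd hW0⟩
  · exact hWc.fst.mono fun x hx => hx.1
  · exact hWc.snd.mono fun x hx => hx.1
  · simpa only [ContinuousLinearMap.coe_fst', systemMatrix_apply] using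
      ((hP hx).clm_comp (ContinuousLinearMap.fst ℝ ℂ ℂ)).eq_add right_mem_uIcc
  · refine (((hP hx).clm_comp (ContinuousLinearMap.snd ℝ ℂ ℂ)).eq_add right_mem_uIcc).trans
      (congrArg _ (intervalIntegral.integral_congr_ae (ae_of_all _ fun t ht => ?_)))
    rw [uIoc_of_le hx] at ht
    have ht' : t ∈ {x : ℝ | 0 < x ∧ (x : EReal) < b} := ⟨ht.1, coe_lt_of_le ht.2 hxb⟩
    have hQt : Q t = q t := indicator_of_mem ht' q
    simp only [systemMatrix_apply, hQt, ContinuousLinearMap.coe_snd']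

namespace IsSolution

theorem primitive_fst (h : IsSolution q b z u v) (hX : 0 ≤ X) (hXb : (X : EReal) < b) :
    IsPrimitiveOn u v 0 X :=
  have hsub := uIcc_zero_subset hX hXb
  .of_eq_add (h.continuousOn_snd.mono hsub).intervalIntegrable fun x hx =>
    h.fst_eq x (hsub hx).1 (hsub hx).2

theorem primitive_snd (h : IsSolution q b z u v) (hq : IsIntegrableUpTo q b) (hX : 0 ≤ X)
    (hXb : (X : EReal) < b) : IsPrimitiveOn v (fun t => ((q t : ℂ) - z) * u t) 0 X :=
  have hsub := uIcc_zero_subset hX hXb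
  .of_eq_add (((intervalIntegrable_ofReal (hq.intervalIntegrable hX hXb)).sub
      intervalIntegrable_const).mul_continuousOn (h.continuousOn_fst.mono hsub)) fun x hx =>
    h.snd_eq x (hsub hx).1 (hsub hx).2

theorem hasDerivWithinAt_Ici (h : IsSolution q b z u v) (hx : 0 ≤ x) (hxb : (x : EReal) < b) :
    HasDerivWithinAt u (v x) (Ici x) x := by
  obtain ⟨X, hxX, hXb⟩ := EReal.lt_iff_exists_real_btwn.1 hxb
  rw [EReal.coe_lt_coe_iff] at hxX
  have hX := hx.trans hxX.le
  have hmem : Icc x X ⊆ uIcc 0 X := by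
    rw [uIcc_of_le hX]
    exact Icc_subset_Icc_left hx
  have hp := h.primitive_fst hX hXb
  have hv : ContinuousOn v (Icc x X) :=
    h.continuousOn_snd.mono (hmem.trans (uIcc_zero_subset hX hXb))
  have hx_mem : x ∈ uIcc 0 X := hmem ⟨le_rfl, hxX.le⟩
  have hint : HasDerivWithinAt (fun y => u 0 + ∫ t in (0 : ℝ)..y, v t) (v x) (Ici x) x := by
    refine HasDerivWithinAt.const_add _
      (intervalIntegral.integral_hasDerivWithinAt_right (t := Ioi x)
        (hp.mono left_mem_uIcc hx_mem).intervalIntegrable ?_ ?_)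
    · rw [← nhdsWithin_Ioo_eq_nhdsGT hxX]
      exact ⟨Ioo x X, self_mem_nhdsWithin,
        (hv.mono Ioo_subset_Icc_self).aestronglyMeasurable measurableSet_Ioo⟩
    · rw [ContinuousWithinAt, ← nhdsWithin_Ioo_eq_nhdsGT hxX]
      exact (hv x ⟨le_rfl, hxX.le⟩).mono Ioo_subset_Icc_self
  refine hint.congr_of_eventuallyEq ?_ (hp.eq_add hx_mem)
  filter_upwards [Ico_mem_nhdsGE hxX] with y hy
  exact hp.eq_add (hmem (Ico_subset_Icc_self hy))

theorem primitive_wronskian (hq : IsIntegrableUpTo q b) {z₁ z₂ : ℂ} (h₁ : IsSolution q b z₁ u₁ v₁)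
    (h₂ : IsSolution q b z₂ u₂ v₂) (hX : 0 ≤ X) (hXb : (X : EReal) < b) :
    IsPrimitiveOn (fun x => u₁ x * v₂ x - v₁ x * u₂ x) (fun x => (z₁ - z₂) * (u₁ x * u₂ x)) 0 X :=
  (((h₁.primitive_fst hX hXb).mul (h₂.primitive_snd hq hX hXb)).sub
    ((h₁.primitive_snd hq hX hXb).mul (h₂.primitive_fst hX hXb))).congr_right fun x _ => by ring

theorem wronskian_eq (hq : IsIntegrableUpTo q b) (h₁ : IsSolution q b z u₁ v₁)
    (h₂ : IsSolution q b z u₂ v₂) (hx : 0 ≤ x) (hxb : (x : EReal) < b) :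
    u₁ x * v₂ x - v₁ x * u₂ x = u₁ 0 * v₂ 0 - v₁ 0 * u₂ 0 := by
  simpa only [sub_self, zero_mul, intervalIntegral.integral_zero, add_zero] using
    (primitive_wronskian hq h₁ h₂ hx hxb).eq_add right_mem_uIcc

theorem conj (h : IsSolution q b z u v) : IsSolution q b (starRingEnd ℂ z)
    (fun x => starRingEnd ℂ (u x)) (fun x => starRingEnd ℂ (v x)) where
  continuousOn_fst := Complex.continuous_conj.comp_continuousOn h.continuousOn_fst
  continuousOn_snd := Complex.continuous_conj.comp_continuousOn h.continuousOn_snd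
  fst_eq x hx hxb := by
    rw [h.fst_eq x hx hxb, map_add, intervalIntegral.integral_of_le hx,
      intervalIntegral.integral_of_le hx, ← integral_conj]
  snd_eq x hx hxb := by
    rw [h.snd_eq x hx hxb, map_add, intervalIntegral.integral_of_le hx,
      intervalIntegral.integral_of_le hx, ← integral_conj]
    simp only [map_mul, map_sub, Complex.conj_ofReal]

theorem lincomb (hq : IsIntegrableUpTo q b) (h₁ : IsSolution q b z u₁ v₁)
    (h₂ : IsSolution q b z u₂ v₂) (c d : ℂ) :
    IsSolution q b z (fun x => c * u₁ x + d * u₂ x) (fun x => c * v₁ x + d * v₂ x) where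
  continuousOn_fst := (h₁.continuousOn_fst.const_smul c).add (h₂.continuousOn_fst.const_smul d)
  continuousOn_snd := (h₁.continuousOn_snd.const_smul c).add (h₂.continuousOn_snd.const_smul d)
  fst_eq x hx hxb := (((h₁.primitive_fst hx hxb).const_mul c).add
    ((h₂.primitive_fst hx hxb).const_mul d)).eq_add right_mem_uIcc
  snd_eq x hx hxb := ((((h₁.primitive_snd hq hx hxb).const_mul c).add
    ((h₂.primitive_snd hq hx hxb).const_mul d)).congr_right fun t _ => by ring).eq_add
      right_mem_uIcc

theorem eq_zero (h : IsSolution q b z u v) (hq : IsIntegrableUpTo q b) (hu : u 0 = 0) (hv : v 0 = 0)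
    (hx : 0 ≤ x) (hxb : (x : EReal) < b) : u x = 0 ∧ v x = 0 := by
  obtain ⟨c, c', hc, -, -, hc0, hc0'⟩ := exists_isSolution hq z (1, 0)
  obtain ⟨s, s', hs, -, -, hs0, hs0'⟩ := exists_isSolution hq z (0, 1)
  have hcs := wronskian_eq hq hc hs hx hxb
  have huc := wronskian_eq hq h hc hx hxb
  have hus := wronskian_eq hq h hs hx hxb
  simp only [hc0, hc0', hs0, hs0', hu, hv] at hcs huc hus
  constructor
  · linear_combination (-u x) * hcs + c x * hus - s x * huc
  · linear_combination (-v x) * hcs + c' x * hus - s' x * huc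

theorem eq_of_eq_at_zero (hq : IsIntegrableUpTo q b) (h₁ : IsSolution q b z u₁ v₁)
    (h₂ : IsSolution q b z u₂ v₂) (hu : u₁ 0 = u₂ 0) (hv : v₁ 0 = v₂ 0) (hx : 0 ≤ x)
    (hxb : (x : EReal) < b) : u₁ x = u₂ x ∧ v₁ x = v₂ x := by
  have h := (lincomb hq h₁ h₂ 1 (-1)).eq_zero hq (by rw [hu]; ring) (by rw [hv]; ring) hx hxb
  constructor
  · linear_combination h.1
  · linear_combination h.2

theorem initial_ne_zero (h : IsSolution q b z u v) (hq : IsIntegrableUpTo q b)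
    (hu : IsNonzero b u) : u 0 ≠ 0 ∨ v 0 ≠ 0 := by
  by_contra! h0
  obtain ⟨x, hx, hxb, hne⟩ := hu
  exact hne (h.eq_zero hq h0.1 h0.2 hx hxb).1

theorem snd_eq_mul (h₁ : IsSolution q b z u₁ v₁) (h₂ : IsSolution q b z u₂ v₂) {c : ℂ}
    (hu : ∀ x : ℝ, 0 ≤ x → (x : EReal) < b → u₁ x = c * u₂ x) (hx : 0 ≤ x)
    (hxb : (x : EReal) < b) : v₁ x = c * v₂ x := by
  obtain ⟨X, hxX, hXb⟩ := EReal.lt_iff_exists_real_btwn.1 hxb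
  rw [EReal.coe_lt_coe_iff] at hxX
  refine (uniqueDiffWithinAt_Ici x).eq_deriv _ (h₁.hasDerivWithinAt_Ici hx hxb)
    (((h₂.hasDerivWithinAt_Ici hx hxb).const_mul c).congr_of_eventuallyEq ?_ (hu x hx hxb))
  filter_upwards [Ico_mem_nhdsGE hxX] with t ht
  exact hu t (hx.trans ht.1) (coe_lt_of_le ht.2.le hXb)

theorem isNonzero (h : IsSolution q b z u v) (hb : 0 < b) (h0 : u 0 ≠ 0 ∨ v 0 ≠ 0) :
    IsNonzero b u := by
  by_contra hu
  have hu0 (x : ℝ) (hx : 0 ≤ x) (hxb : (x : EReal) < b) : u x = 0 * u x := by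
    rw [zero_mul]
    by_contra hne
    exact hu ⟨x, hx, hxb, hne⟩
  have hv0 := h.snd_eq_mul h hu0 le_rfl (by exact_mod_cast hb)
  have hu00 := hu0 0 le_rfl (by exact_mod_cast hb)
  rw [zero_mul] at hv0 hu00
  exact h0.elim (· hu00) (· hv0)

end IsSolution

end Solutions

section Weyl

variable {q : ℝ → ℝ} {b : EReal} {z : ℂ} {u v u₁ v₁ u₂ v₂ : ℝ → ℂ} {x y : ℝ}

theorem exists_norm_eq_one_mul_add_mul_eq_zero (l₁ l₂ : ℂ) :
    ∃ w : ℂ × ℂ, ‖w‖ = 1 ∧ w.1 * l₁ + w.2 * l₂ = 0 := by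
  obtain ⟨w, hw, hw0⟩ : ∃ w : ℂ × ℂ, w ≠ 0 ∧ w.1 * l₁ + w.2 * l₂ = 0 := by
    by_cases h : l₁ = 0
    · exact ⟨(1, 0), by simp, by simp [h]⟩
    · exact ⟨(-l₂, l₁), by simp [h], by ring⟩
  refine ⟨((‖w‖ : ℂ)⁻¹) • w, norm_smul_inv_norm hw, ?_⟩
  simp only [Prod.smul_fst, Prod.smul_snd, smul_eq_mul]
  linear_combination (‖w‖ : ℂ)⁻¹ * hw0

theorem exists_fundamentalSystem (hq : IsIntegrableUpTo q b) (hb : 0 < b) (z : ℂ) :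
    ∃ c c' s s' : ℝ → ℂ, IsSolution q b z c c' ∧ IsSolution q b z s s' ∧
      (ContinuousOn c (Ici 0) ∧ ContinuousOn c' (Ici 0) ∧
        ContinuousOn s (Ici 0) ∧ ContinuousOn s' (Ici 0)) ∧
      ∀ w : ℂ × ℂ, ‖w‖ = 1 → IsNonzero b fun x => w.1 * c x + w.2 * s x := by
  obtain ⟨c, c', hc, hcc, hcc', hc0, hc0'⟩ := exists_isSolution hq z (1, 0)
  obtain ⟨s, s', hs, hsc, hsc', hs0, hs0'⟩ := exists_isSolution hq z (0, 1)
  refine ⟨c, c', s, s', hc, hs, ⟨hcc, hcc', hsc, hsc'⟩, fun w hw =>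
    (IsSolution.lincomb hq hc hs w.1 w.2).isNonzero hb ?_⟩
  by_contra! h0
  rw [hc0, hs0, hc0', hs0'] at h0
  have hw0 : w = 0 := Prod.ext (by simpa using h0.1) (by simpa using h0.2)
  simp [hw0] at hw

theorem exists_isSolution_boundary (hq : IsIntegrableUpTo q b) (hb : 0 < b) (z α β : ℂ) {X : ℝ}
    (hX : 0 < X) :
    ∃ u v, IsSolution q b z u v ∧ IsNonzero b u ∧ ContinuousAt u X ∧ ContinuousAt v X ∧
      α * v X + β * u X = 0 := by
  obtain ⟨c, c', s, s', hc, hs, ⟨hcc, hcc', hsc, hsc'⟩, hne⟩ := exists_fundamentalSystem hq hb z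
  obtain ⟨w, hw, h0⟩ :=
    exists_norm_eq_one_mul_add_mul_eq_zero (α * c' X + β * c X) (α * s' X + β * s X)
  exact ⟨_, _, .lincomb hq hc hs w.1 w.2, hne w hw,
    ((hcc.const_smul w.1).add (hsc.const_smul w.2)).continuousAt (Ici_mem_nhds hX),
    ((hcc'.const_smul w.1).add (hsc'.const_smul w.2)).continuousAt (Ici_mem_nhds hX),
    by linear_combination h0⟩

/-- The imaginary part of `u' ū`, where `v = u'`. It is the Wronskian of `ū` and `u` up to a factor,
and for `Im z > 0` it decreases along solutions. -/
noncomputable def flux (u v : ℝ → ℂ) (x : ℝ) : ℝ := (v x * starRingEnd ℂ (u x)).im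

theorem wronskian_conj_eq (u v : ℝ → ℂ) (x : ℝ) :
    u x * starRingEnd ℂ (v x) - v x * starRingEnd ℂ (u x) = ((-2 * flux u v x : ℝ) : ℂ) *
      Complex.I := by
  have h : u x * starRingEnd ℂ (v x) = starRingEnd ℂ (v x * starRingEnd ℂ (u x)) := by
    rw [map_mul, Complex.conj_conj, mul_comm]
  rw [h, ← neg_sub, Complex.sub_conj, flux]
  push_cast
  ring

theorem flux_mul (c : ℂ) (u v : ℝ → ℂ) (x : ℝ) :
    flux (fun t => c * u t) (fun t => c * v t) x = ‖c‖ ^ 2 * flux u v x := by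
  rw [flux, flux, ← Complex.im_ofReal_mul, ← Complex.normSq_eq_norm_sq, ← Complex.mul_conj, map_mul]
  ring_nf

theorem IsL2AtTop.conj (hu : IsL2AtTop u) : IsL2AtTop fun x => starRingEnd ℂ (u x) := by
  simpa only [IsL2AtTop, RCLike.norm_conj] using hu

namespace IsSolution

theorem continuousOn_Ici (h : IsSolution q ⊤ z u v) : ContinuousOn u (Ici 0) :=
  h.continuousOn_fst.mono fun x hx => ⟨hx, EReal.coe_lt_top x⟩

theorem primitive_mul_conj (h : IsSolution q b z u v) (hq : IsIntegrableUpTo q b) {X : ℝ}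
    (hX : 0 ≤ X) (hXb : (X : EReal) < b) :
    IsPrimitiveOn (fun x => v x * starRingEnd ℂ (u x))
      (fun x => ((‖v x‖ ^ 2 + q x * ‖u x‖ ^ 2 : ℝ) : ℂ) - z * (‖u x‖ ^ 2 : ℝ)) 0 X := by
  refine ((h.primitive_snd hq hX hXb).mul (h.conj.primitive_fst hX hXb)).congr_right fun x _ => ?_
  rw [mul_assoc, Complex.mul_conj, Complex.mul_conj, Complex.normSq_eq_norm_sq,
    Complex.normSq_eq_norm_sq]
  push_cast
  ring

theorem primitive_flux (h : IsSolution q b z u v) (hq : IsIntegrableUpTo q b) {X : ℝ}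
    (hX : 0 ≤ X) (hXb : (X : EReal) < b) :
    IsPrimitiveOn (flux u v) (fun x => -z.im * ‖u x‖ ^ 2) 0 X := by
  refine ((h.primitive_mul_conj hq hX hXb).clm_comp Complex.imCLM).congr_right fun x _ => ?_
  rw [Complex.imCLM_apply, Complex.sub_im, Complex.ofReal_im, Complex.im_mul_ofReal, zero_sub,
    neg_mul]

theorem flux_sub (h : IsSolution q b z u v) (hq : IsIntegrableUpTo q b) (hx : 0 ≤ x) (hxy : x ≤ y)
    (hyb : (y : EReal) < b) : flux u v x - flux u v y = z.im * ∫ t in x..y, ‖u t‖ ^ 2 := by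
  have hy := hx.trans hxy
  have hsub := (h.primitive_flux hq hy hyb).sub_eq (Icc_subset_uIcc ⟨hx, hxy⟩) right_mem_uIcc
  rw [intervalIntegral.integral_const_mul] at hsub
  linarith

theorem flux_le (h : IsSolution q b z u v) (hq : IsIntegrableUpTo q b) (hz : 0 < z.im)
    (hx : 0 ≤ x) (hxy : x ≤ y) (hyb : (y : EReal) < b) : flux u v y ≤ flux u v x := by
  have hsub := h.flux_sub hq hx hxy hyb
  have hint : 0 ≤ ∫ t in x..y, ‖u t‖ ^ 2 :=
    intervalIntegral.integral_nonneg hxy fun t _ => by positivity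
  linarith [mul_nonneg hz.le hint]

theorem flux_nonneg_of_tendsto (h : IsSolution q ⊤ z u v) (hq : IsIntegrableUpTo q ⊤)
    (hz : 0 < z.im) (hflux : Tendsto (flux u v) atTop (𝓝 0)) (hx : 0 ≤ x) : 0 ≤ flux u v x := by
  refine le_of_tendsto hflux ?_
  filter_upwards [eventually_ge_atTop x] with y hy
  exact h.flux_le hq hz hx hy (EReal.coe_lt_top y)

theorem intervalIntegrable_norm_sq (h : IsSolution q ⊤ z u v) (hx : 0 ≤ x) (hy : 0 ≤ y) :
    IntervalIntegrable (fun t => ‖u t‖ ^ 2) volume x y :=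
  ((h.continuousOn_Ici.mono fun _ ht => (le_min hx hy).trans ht.1).norm.pow 2).intervalIntegrable

theorem isL2AtTop_of_flux_nonneg (h : IsSolution q ⊤ z u v) (hq : IsIntegrableUpTo q ⊤)
    (hz : 0 < z.im) (hu : ∀ x, 0 ≤ x → 0 ≤ flux u v x) : IsL2AtTop u := by
  refine ⟨0, le_rfl, integrableOn_Ioi_of_intervalIntegral_norm_bounded (flux u v 0 / z.im) 0
    (fun X => ?_) tendsto_id ?_⟩
  · rcases le_total 0 X with hX | hX
    · exact (h.intervalIntegrable_norm_sq le_rfl hX).1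
    · simp [Ioc_eq_empty_of_le hX]
  · filter_upwards [eventually_ge_atTop 0] with X hX
    rw [le_div_iff₀ hz]
    simp only [norm_pow, norm_norm, id_eq]
    linarith [hu X hX, h.flux_sub hq le_rfl hX (EReal.coe_lt_top X)]

theorem integrableOn_norm_sq (h : IsSolution q ⊤ z u v) (hu : IsL2AtTop u) :
    IntegrableOn (fun x => ‖u x‖ ^ 2) (Ioi 0) := by
  obtain ⟨R, hR, hint⟩ := hu
  rw [← Ioc_union_Ioi_eq_Ioi hR]
  exact (h.intervalIntegrable_norm_sq le_rfl hR).1.union hint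

-- Weyl's nested discs: the solutions vanishing at `N` have nonnegative flux on `[0, N]`, and by
-- compactness their normalized initial values accumulate as `N → ∞`.
theorem exists_flux_nonneg (hq : IsIntegrableUpTo q ⊤) (hz : 0 < z.im) :
    ∃ u v : ℝ → ℂ, IsSolution q ⊤ z u v ∧ IsNonzero ⊤ u ∧ ∀ x, 0 ≤ x → 0 ≤ flux u v x := by
  obtain ⟨c, c', s, s', hc, hs, -, hne⟩ := exists_fundamentalSystem hq EReal.zero_lt_top z
  have hsol (w : ℂ × ℂ) := lincomb hq hc hs w.1 w.2
  choose w hw hw0 using fun N : ℕ => exists_norm_eq_one_mul_add_mul_eq_zero (c N) (s N)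
  obtain ⟨w₀, hw₀, φ, hφ, hlim⟩ := (isCompact_sphere (0 : ℂ × ℂ) 1).tendsto_subseq
    fun N => mem_sphere_zero_iff_norm.2 (hw N)
  refine ⟨_, _, hsol w₀, hne w₀ (mem_sphere_zero_iff_norm.1 hw₀), fun x hx => ?_⟩
  have hcont : Continuous fun w : ℂ × ℂ =>
      flux (fun t => w.1 * c t + w.2 * s t) (fun t => w.1 * c' t + w.2 * s' t) x := by
    unfold flux
    fun_prop
  refine ge_of_tendsto ((hcont.tendsto w₀).comp hlim) ?_
  filter_upwards [hφ.tendsto_atTop.eventually_ge_atTop ⌈x⌉₊] with n hn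
  have hx_le : x ≤ φ n := (Nat.le_ceil x).trans (by exact_mod_cast hn)
  refine le_trans (le_of_eq ?_) ((hsol (w (φ n))).flux_le hq hz hx hx_le (EReal.coe_lt_top _))
  simp [flux, hw0]

theorem exists_isL2AtTop (hq : IsIntegrableUpTo q ⊤) (hz : 0 < z.im) :
    ∃ u v : ℝ → ℂ, IsSolution q ⊤ z u v ∧ IsNonzero ⊤ u ∧ IsL2AtTop u := by
  obtain ⟨u, v, h, hne, hflux⟩ := exists_flux_nonneg hq hz
  exact ⟨u, v, h, hne, h.isL2AtTop_of_flux_nonneg hq hz hflux⟩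

theorem flux_nonneg_of_isLimitPoint (hlp : IsLimitPoint q) (hq : IsIntegrableUpTo q ⊤)
    (h : IsSolution q ⊤ z u v) (hz : 0 < z.im) (hu : IsL2AtTop u) (hx : 0 ≤ x) :
    0 ≤ flux u v x := by
  obtain ⟨u₁, v₁, h₁, ⟨y, hy, -, hne⟩, hflux⟩ := exists_flux_nonneg hq hz
  obtain ⟨u₂, v₂, -, -, -, huniq⟩ := hlp z hz
  obtain ⟨c, hc⟩ := huniq u v h hu
  obtain ⟨d, hd⟩ := huniq u₁ v₁ h₁ (h₁.isL2AtTop_of_flux_nonneg hq hz hflux)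
  have hd0 : d ≠ 0 := by
    rintro rfl
    exact hne (by rw [hd y hy, zero_mul])
  have hu' (t : ℝ) (ht : 0 ≤ t) : u t = c / d * u₁ t := by
    rw [hc t ht, hd t ht]
    field_simp
  have hv' := h.snd_eq_mul h₁ (fun t ht _ => hu' t ht) hx (EReal.coe_lt_top x)
  have hmul : flux u v x = ‖c / d‖ ^ 2 * flux u₁ v₁ x := by
    rw [← flux_mul, flux, flux, hu' x hx, hv']
  rw [hmul]
  exact mul_nonneg (by positivity) (hflux x hx)

theorem exists_tendsto_wronskian (hq : IsIntegrableUpTo q ⊤) {z₁ z₂ : ℂ}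
    (h₁ : IsSolution q ⊤ z₁ u₁ v₁) (h₂ : IsSolution q ⊤ z₂ u₂ v₂) (hu₁ : IsL2AtTop u₁)
    (hu₂ : IsL2AtTop u₂) : ∃ l, Tendsto (fun x => u₁ x * v₂ x - v₁ x * u₂ x) atTop (𝓝 l) := by
  have hint : IntegrableOn (fun x => (z₁ - z₂) * (u₁ x * u₂ x)) (Ioi 0) := by
    refine (Integrable.mono' ((h₁.integrableOn_norm_sq hu₁).add (h₂.integrableOn_norm_sq hu₂))
      (((h₁.continuousOn_Ici.mul h₂.continuousOn_Ici).mono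
        Ioi_subset_Ici_self).aestronglyMeasurable measurableSet_Ioi)
      (ae_of_all _ fun x => ?_)).const_mul _
    rw [Pi.mul_apply, norm_mul, Pi.add_apply]
    nlinarith [sq_nonneg (‖u₁ x‖ - ‖u₂ x‖), sq_nonneg (‖u₁ x‖ + ‖u₂ x‖)]
  refine ⟨_, ((intervalIntegral_tendsto_integral_Ioi 0 hint tendsto_id).const_add
    (u₁ 0 * v₂ 0 - v₁ 0 * u₂ 0)).congr' ?_⟩
  filter_upwards [eventually_ge_atTop 0] with x hx
  exact ((primitive_wronskian hq h₁ h₂ hx (EReal.coe_lt_top x)).eq_add right_mem_uIcc).symm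

theorem exists_wronskian_eq_one (hq : IsIntegrableUpTo q b) (h : IsSolution q b z u v)
    (hu : IsNonzero b u) :
    ∃ w w' : ℝ → ℂ, IsSolution q b z w w' ∧
      ∀ x : ℝ, 0 ≤ x → (x : EReal) < b → u x * w' x - v x * w x = 1 := by
  obtain ⟨c, h0⟩ : ∃ c : ℂ × ℂ, u 0 * c.2 - v 0 * c.1 = 1 := by
    rcases h.initial_ne_zero hq hu with h0 | h0
    · exact ⟨(0, (u 0)⁻¹), by simp [h0]⟩
    · exact ⟨(-(v 0)⁻¹, 0), by simp [h0]⟩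
  obtain ⟨w, w', hw, -, -, hw0, hw0'⟩ := exists_isSolution hq z c
  refine ⟨w, w', hw, fun x hx hxb => ?_⟩
  rw [wronskian_eq hq h hw hx hxb, hw0, hw0', h0]

end IsSolution

-- Plücker's relation `W(f, g) W(u₀, w) = W(f, w) W(u₀, g) - W(g, w) W(u₀, f)` for the Wronskian.
theorem tendsto_wronskian_zero {u₀ v₀ w w' f f' g g' : ℝ → ℂ} {l l' : ℂ}
    (hw : ∀ᶠ x in atTop, u₀ x * w' x - v₀ x * w x = 1)
    (hfw : Tendsto (fun x => f x * w' x - f' x * w x) atTop (𝓝 l))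
    (hgw : Tendsto (fun x => g x * w' x - g' x * w x) atTop (𝓝 l'))
    (hf : Tendsto (fun x => u₀ x * f' x - v₀ x * f x) atTop (𝓝 0))
    (hg : Tendsto (fun x => u₀ x * g' x - v₀ x * g x) atTop (𝓝 0)) :
    Tendsto (fun x => f x * g' x - f' x * g x) atTop (𝓝 0) := by
  have hlim := (hfw.mul hg).sub (hgw.mul hf)
  rw [mul_zero, mul_zero, sub_zero] at hlim
  refine hlim.congr' ?_
  filter_upwards [hw] with x hx
  linear_combination (f x * g' x - f' x * g x) * hx

theorem IsSolution.flux_nonneg_of_isLimitCircle (hlc : IsLimitCircle q)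
    (hq : IsIntegrableUpTo q ⊤) {u₀ v₀ : ℝ → ℂ} (h₀ : IsSolution q ⊤ Complex.I u₀ v₀)
    (hne : IsNonzero ⊤ u₀)
    (hsa : Tendsto (fun x => u₀ x * star (v₀ x) - v₀ x * star (u₀ x)) atTop (𝓝 0))
    (h : IsSolution q ⊤ z u v) (hz : 0 < z.im)
    (hu : Tendsto (fun x => u₀ x * v x - v₀ x * u x) atTop (𝓝 0)) (hx : 0 ≤ x) :
    0 ≤ flux u v x := by
  obtain ⟨w, w', hw, hW⟩ := exists_wronskian_eq_one hq h₀ hne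
  have hW' : ∀ᶠ x in atTop, u₀ x * w' x - v₀ x * w x = 1 := by
    filter_upwards [eventually_ge_atTop 0] with x hx using hW x hx (EReal.coe_lt_top x)
  have hI : 0 < Complex.I.im := by simp
  have hwL2 := hlc _ hI w w' hw
  have huL2 := hlc z hz u v h
  have hu₀L2 := hlc _ hI u₀ v₀ h₀
  obtain ⟨l₁, huw⟩ := exists_tendsto_wronskian hq h hw huL2 hwL2
  obtain ⟨l₂, hcuw⟩ := exists_tendsto_wronskian hq h.conj hw huL2.conj hwL2
  obtain ⟨l₃, hcu₀w⟩ := exists_tendsto_wronskian hq h₀.conj hw hu₀L2.conj hwL2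
  have hucu₀ := tendsto_wronskian_zero hW' huw hcu₀w hu hsa
  have hu₀cu : Tendsto (fun x => u₀ x * starRingEnd ℂ (v x) - v₀ x * starRingEnd ℂ (u x)) atTop
      (𝓝 0) := by
    have hconj := ((Complex.continuous_conj.tendsto 0).comp hucu₀).neg
    rw [map_zero, neg_zero] at hconj
    refine hconj.congr fun x => ?_
    simp only [Function.comp_apply, map_sub, map_mul, Complex.conj_conj]
    ring
  have hucu := tendsto_wronskian_zero hW' huw hcuw hu hu₀cu
  refine h.flux_nonneg_of_tendsto hq hz ?_ hx
  have him := ((Complex.continuous_im.tendsto 0).comp hucu).const_mul (-1 / 2)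
  rw [Complex.zero_im, mul_zero] at him
  refine him.congr fun y => ?_
  rw [Function.comp_apply, wronskian_conj_eq, Complex.im_ofReal_mul, Complex.I_im]
  ring

end Weyl

section EssBddBelow

variable {q : ℝ → ℝ} {z : ℂ} {u v : ℝ → ℂ} {a b x y X Y : ℝ}

theorem frequently_lt_of_integrableOn_Ioi {f : ℝ → ℝ} {R c : ℝ} (hf : IntegrableOn f (Ioi R))
    (hc : 0 < c) : ∃ᶠ x in atTop, f x < c := by
  intro hcon
  obtain ⟨S, hS⟩ := eventually_atTop.1 hcon
  have hfS : IntegrableOn f (Ioi (max R S)) := hf.mono_set (Ioi_subset_Ioi (le_max_left R S))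
  have hconst : IntegrableOn (fun _ : ℝ => c) (Ioi (max R S)) := by
    refine hfS.mono' aestronglyMeasurable_const ?_
    filter_upwards [ae_restrict_mem measurableSet_Ioi] with x hx
    rw [Real.norm_of_nonneg hc.le]
    exact not_lt.1 (hS x ((le_max_right R S).trans hx.le))
  simp [integrableOn_const_iff, hc.ne'] at hconst

theorem norm_two_mul_re_mul_conj_le {ε : ℝ} (hε : 0 < ε) (w₁ w₂ : ℂ) :
    ‖2 * (w₁ * starRingEnd ℂ w₂).re‖ ≤ ε⁻¹ * ‖w₂‖ ^ 2 + ε * ‖w₁‖ ^ 2 := by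
  have hre := Complex.abs_re_le_norm (w₁ * starRingEnd ℂ w₂)
  rw [norm_mul, RCLike.norm_conj] at hre
  have hsq : 0 ≤ ε * (ε⁻¹ * ‖w₂‖ - ‖w₁‖) ^ 2 := by positivity
  have hexpand : ε * (ε⁻¹ * ‖w₂‖ - ‖w₁‖) ^ 2 =
      ε⁻¹ * ‖w₂‖ ^ 2 + ε * ‖w₁‖ ^ 2 - 2 * (‖w₁‖ * ‖w₂‖) := by
    field_simp
    ring
  rw [norm_mul, Real.norm_eq_abs, Real.norm_eq_abs, abs_two]
  linarith

theorem IsIntegrableUpTo.intervalIntegrable_top (hq : IsIntegrableUpTo q ⊤) (hx : 0 ≤ x)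
    (hy : 0 ≤ y) : IntervalIntegrable q volume x y :=
  (hq.intervalIntegrable hx (EReal.coe_lt_top x)).symm.trans
    (hq.intervalIntegrable hy (EReal.coe_lt_top y))

theorem IsIntegrableUpTo.intervalIntegrable_negPart (hq : IsIntegrableUpTo q ⊤) (hx : 0 ≤ x)
    (hy : 0 ≤ y) : IntervalIntegrable (fun t => max (-q t) 0) volume x y :=
  ⟨(hq.intervalIntegrable_top hx hy).1.neg.sup (integrable_const _),
    (hq.intervalIntegrable_top hx hy).2.neg.sup (integrable_const _)⟩

namespace IsPrimitiveOn

theorem norm_sq (h : IsPrimitiveOn u v a b) :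
    IsPrimitiveOn (fun x => ‖u x‖ ^ 2) (fun x => 2 * (v x * starRingEnd ℂ (u x)).re) a b := by
  have hre := ((h.mul (h.clm_comp (Complex.conjCLE : ℂ →L[ℝ] ℂ))).clm_comp Complex.reCLM)
  refine (hre.congr_left fun x _ => ?_).congr_right fun x _ => ?_
  · simp only [ContinuousLinearEquiv.coe_coe, Complex.conjCLE_apply, Complex.reCLM_apply,
      Complex.mul_conj, Complex.normSq_eq_norm_sq, Complex.ofReal_re]
  · simp only [ContinuousLinearEquiv.coe_coe, Complex.conjCLE_apply, Complex.reCLM_apply,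
      Complex.add_re, Complex.mul_re, Complex.conj_re, Complex.conj_im]
    ring

theorem norm_sq_le {s t ε : ℝ} (h : IsPrimitiveOn u v s (s + 1))
    (hv : IntervalIntegrable (fun t => ‖v t‖ ^ 2) volume s (s + 1)) (hε : 0 < ε)
    (ht : t ∈ Icc s (s + 1)) :
    ‖u t‖ ^ 2 ≤ (1 + ε⁻¹) * (∫ t in s..s + 1, ‖u t‖ ^ 2) + ε * ∫ t in s..s + 1, ‖v t‖ ^ 2 := by
  have hs : s ≤ s + 1 := by linarith
  have hu : IntervalIntegrable (fun t => ‖u t‖ ^ 2) volume s (s + 1) :=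
    (h.continuousOn.norm.pow 2).intervalIntegrable
  have hIcc := uIcc_of_le hs
  obtain ⟨r, hr, hmin⟩ := isCompact_Icc.exists_isMinOn (nonempty_Icc.2 hs)
    (hIcc ▸ h.continuousOn.norm.pow 2)
  have hr_le : ‖u r‖ ^ 2 ≤ ∫ t in s..s + 1, ‖u t‖ ^ 2 := by
    simpa using intervalIntegral.integral_mono_on hs intervalIntegrable_const hu
      fun x hx => hmin hx
  have hg := (hu.const_mul ε⁻¹).add (hv.const_mul ε)
  have hsub : uIoc r t ⊆ uIoc s (s + 1) := by
    rw [uIoc_of_le hs]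
    exact Ioc_subset_Ioc (le_min hr.1 ht.1) (max_le hr.2 ht.2)
  have hgrowth : ‖u t‖ ^ 2 - ‖u r‖ ^ 2 ≤
      ∫ t in s..s + 1, (ε⁻¹ * ‖u t‖ ^ 2 + ε * ‖v t‖ ^ 2) := by
    rw [h.norm_sq.sub_eq (hIcc ▸ hr) (hIcc ▸ ht)]
    calc _ ≤ ‖∫ t in r..t, 2 * (v t * starRingEnd ℂ (u t)).re‖ := le_abs_self _
      _ ≤ |∫ t in r..t, (ε⁻¹ * ‖u t‖ ^ 2 + ε * ‖v t‖ ^ 2)| :=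
        intervalIntegral.norm_integral_le_abs_of_norm_le (ae_of_all _ fun x =>
          norm_two_mul_re_mul_conj_le hε (v x) (u x))
          (hg.mono_set (uIcc_subset_uIcc (hIcc ▸ hr) (hIcc ▸ ht)))
      _ ≤ |∫ t in s..s + 1, (ε⁻¹ * ‖u t‖ ^ 2 + ε * ‖v t‖ ^ 2)| :=
        intervalIntegral.abs_integral_mono_interval hsub (ae_of_all _ fun x => by positivity) hg
      _ = _ := abs_of_nonneg (intervalIntegral.integral_nonneg hs fun x _ => by positivity)
  rw [intervalIntegral.integral_add (hu.const_mul _) (hv.const_mul _),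
    intervalIntegral.integral_const_mul, intervalIntegral.integral_const_mul] at hgrowth
  linarith

end IsPrimitiveOn

namespace IsSolution

theorem continuousOn_snd_Ici (h : IsSolution q ⊤ z u v) : ContinuousOn v (Ici 0) :=
  h.continuousOn_snd.mono fun x hx => ⟨hx, EReal.coe_lt_top x⟩

theorem intervalIntegrable_norm_sq_snd (h : IsSolution q ⊤ z u v) (hx : 0 ≤ x) (hy : 0 ≤ y) :
    IntervalIntegrable (fun t => ‖v t‖ ^ 2) volume x y :=
  ((h.continuousOn_snd_Ici.mono
    fun _ ht => (le_min hx hy).trans ht.1).norm.pow 2).intervalIntegrable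

theorem primitive (h : IsSolution q ⊤ z u v) (hx : 0 ≤ x) (hxy : x ≤ y) :
    IsPrimitiveOn u v x y :=
  (h.primitive_fst (hx.trans hxy) (EReal.coe_lt_top y)).mono (Icc_subset_uIcc ⟨hx, hxy⟩)
    right_mem_uIcc

theorem frequently_re_le_one (h : IsSolution q ⊤ z u v) (hu : IsL2AtTop u) :
    ∃ᶠ x in atTop, (v x * starRingEnd ℂ (u x)).re ≤ 1 := by
  intro hcon
  obtain ⟨T, hT⟩ := eventually_atTop.1 (hcon.and (eventually_ge_atTop 0))
  have hT0 := (hT T le_rfl).2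
  have hgrowth : ∀ x, T + 1 ≤ x → 1 ≤ ‖u x‖ ^ 2 := fun x hx => by
    have hTx : T ≤ x := by linarith
    have hp := (h.primitive hT0 hTx).norm_sq
    have hmono : ∫ _ in T..x, (2 : ℝ) ≤ ∫ t in T..x, 2 * (v t * starRingEnd ℂ (u t)).re :=
      intervalIntegral.integral_mono_on hTx intervalIntegrable_const hp.intervalIntegrable
        fun t ht => by linarith [not_le.1 (hT t ht.1).1]
    rw [intervalIntegral.integral_const, smul_eq_mul, ← hp.sub_eq left_mem_uIcc right_mem_uIcc]
      at hmono
    linarith [sq_nonneg ‖u T‖]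
  obtain ⟨R, -, hR⟩ := hu
  refine frequently_lt_of_integrableOn_Ioi hR one_pos ?_
  filter_upwards [eventually_ge_atTop (T + 1)] with x hx
  exact not_lt.2 (hgrowth x hx)

theorem intervalIntegrable_negPart_mul (h : IsSolution q ⊤ z u v) (hq : IsIntegrableUpTo q ⊤)
    (hx : 0 ≤ x) (hy : 0 ≤ y) :
    IntervalIntegrable (fun t => max (-q t) 0 * ‖u t‖ ^ 2) volume x y :=
  (hq.intervalIntegrable_negPart hx hy).mul_continuousOn
    ((h.continuousOn_Ici.mono fun _ ht => (le_min hx hy).trans ht.1).norm.pow 2)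

theorem integral_negPart_mul_le_of_unit (h : IsSolution q ⊤ z u v) (hq : IsIntegrableUpTo q ⊤)
    {C ε : ℝ} (hC : ∫ t in X..X + 1, max (-q t) 0 ≤ C) (hε : 0 < ε) (hX : 0 ≤ X) :
    ∫ t in X..X + 1, max (-q t) 0 * ‖u t‖ ^ 2 ≤
      C * ((1 + ε⁻¹) * (∫ t in X..X + 1, ‖u t‖ ^ 2) + ε * ∫ t in X..X + 1, ‖v t‖ ^ 2) := by
  have hXle : X ≤ X + 1 := by linarith
  have hX1 := hX.trans hXle
  have hu : 0 ≤ ∫ t in X..X + 1, ‖u t‖ ^ 2 :=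
    intervalIntegral.integral_nonneg hXle fun _ _ => by positivity
  have hv : 0 ≤ ∫ t in X..X + 1, ‖v t‖ ^ 2 :=
    intervalIntegral.integral_nonneg hXle fun _ _ => by positivity
  have hsobolev := fun t (ht : t ∈ Icc X (X + 1)) =>
    (h.primitive hX hXle).norm_sq_le (h.intervalIntegrable_norm_sq_snd hX hX1) hε ht
  refine (intervalIntegral.integral_mono_on hXle (h.intervalIntegrable_negPart_mul hq hX hX1)
    ((hq.intervalIntegrable_negPart hX hX1).mul_const _) fun t ht =>
      mul_le_mul_of_nonneg_left (hsobolev t ht) (le_max_right _ _)).trans ?_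
  rw [intervalIntegral.integral_mul_const]
  exact mul_le_mul_of_nonneg_right hC (by positivity)

theorem integral_negPart_mul_le (h : IsSolution q ⊤ z u v) (hq : IsIntegrableUpTo q ⊤) {C ε : ℝ}
    (hC : ∀ a : ℝ, 0 < a → ∫ x in a..(a + 1), max (-q x) 0 ≤ C) (hε : 0 < ε) (hX : 0 < X) (n : ℕ) :
    ∫ t in X..X + n, max (-q t) 0 * ‖u t‖ ^ 2 ≤
      C * ((1 + ε⁻¹) * (∫ t in X..X + n, ‖u t‖ ^ 2) + ε * ∫ t in X..X + n, ‖v t‖ ^ 2) := by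
  induction n with
  | zero => simp
  | succ n ih =>
    have hn : 0 < X + n := by positivity
    have hn1 : 0 ≤ X + n + 1 := by positivity
    have hstep := h.integral_negPart_mul_le_of_unit hq (hC (X + n) hn) hε hn.le
    push_cast
    rw [← add_assoc, ← intervalIntegral.integral_add_adjacent_intervals
        (h.intervalIntegrable_negPart_mul hq hX.le hn.le)
        (h.intervalIntegrable_negPart_mul hq hn.le hn1),
      ← intervalIntegral.integral_add_adjacent_intervals
        (h.intervalIntegrable_norm_sq hX.le hn.le) (h.intervalIntegrable_norm_sq hn.le hn1),
      ← intervalIntegral.integral_add_adjacent_intervals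
        (h.intervalIntegrable_norm_sq_snd hX.le hn.le) (h.intervalIntegrable_norm_sq_snd hn.le hn1)]
    linarith

theorem integral_norm_sq_snd_le (h : IsSolution q ⊤ z u v) (hq : IsIntegrableUpTo q ⊤)
    (hX : 0 ≤ X) (hXY : X ≤ Y) :
    ∫ t in X..Y, ‖v t‖ ^ 2 ≤ (v Y * starRingEnd ℂ (u Y)).re - (v X * starRingEnd ℂ (u X)).re +
      (∫ t in X..Y, max (-q t) 0 * ‖u t‖ ^ 2) + |z.re| * ∫ t in X..Y, ‖u t‖ ^ 2 := by
  have hY := hX.trans hXY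
  have hp := ((h.primitive_mul_conj hq hY (EReal.coe_lt_top Y)).clm_comp Complex.reCLM).mono
    (Icc_subset_uIcc ⟨hX, hXY⟩) right_mem_uIcc
  have hneg := h.intervalIntegrable_negPart_mul hq hX hY
  have hu := (h.intervalIntegrable_norm_sq hX hY).const_mul |z.re|
  rw [← Complex.reCLM_apply, ← Complex.reCLM_apply, hp.sub_eq left_mem_uIcc right_mem_uIcc,
    ← intervalIntegral.integral_const_mul,
    ← intervalIntegral.integral_add hp.intervalIntegrable hneg,
    ← intervalIntegral.integral_add (hp.intervalIntegrable.add hneg) hu]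
  refine intervalIntegral.integral_mono_on hXY (h.intervalIntegrable_norm_sq_snd hX hY)
    ((hp.intervalIntegrable.add hneg).add hu) fun t _ => ?_
  simp only [Complex.reCLM_apply, Complex.sub_re, Complex.ofReal_re, Complex.re_mul_ofReal]
  have hqt := mul_le_mul_of_nonneg_right (le_max_left (-q t) 0) (sq_nonneg ‖u t‖)
  have hzt := mul_le_mul_of_nonneg_right (le_abs_self z.re) (sq_nonneg ‖u t‖)
  linarith

-- The Sobolev inequality absorbs the negative part of `q` into half of `∫ |u'|²`.
theorem integral_norm_sq_snd_le_of_mul_le_half (h : IsSolution q ⊤ z u v)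
    (hq : IsIntegrableUpTo q ⊤) {C ε : ℝ}
    (hC : ∀ a : ℝ, 0 < a → ∫ x in a..(a + 1), max (-q x) 0 ≤ C) (hε : 0 < ε) (hCε : C * ε ≤ 1 / 2)
    (hX : 0 < X) (n : ℕ) :
    ∫ t in X..X + n, ‖v t‖ ^ 2 ≤ 2 * ((v (X + n) * starRingEnd ℂ (u (X + n))).re -
      (v X * starRingEnd ℂ (u X)).re + (|z.re| + C * (1 + ε⁻¹)) * ∫ t in X..X + n, ‖u t‖ ^ 2) := by
  have hXY : X ≤ X + n := by simp
  have henergy := h.integral_norm_sq_snd_le hq hX.le hXY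
  have hneg := h.integral_negPart_mul_le hq hC hε hX n
  have hV : 0 ≤ ∫ t in X..X + n, ‖v t‖ ^ 2 :=
    intervalIntegral.integral_nonneg hXY fun _ _ => by positivity
  have habsorb := mul_le_mul_of_nonneg_right hCε hV
  linarith

-- The energy identity bounds `∫ |u'|²` up to any point where `Re (u' ū) ≤ 1`.
theorem exists_integral_norm_sq_snd_le (hbd : IsEssBddBelow q) (hq : IsIntegrableUpTo q ⊤)
    (h : IsSolution q ⊤ z u v) (hu : IsL2AtTop u) :
    ∃ D, ∀ Y, 2 ≤ Y → (v Y * starRingEnd ℂ (u Y)).re ≤ 1 → ∫ t in (2 : ℝ)..Y, ‖v t‖ ^ 2 ≤ D := by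
  obtain ⟨C, hC⟩ := hbd
  have hC0 : 0 ≤ C := (intervalIntegral.integral_nonneg (by norm_num)
    fun _ _ => le_max_right _ _).trans (hC 1 one_pos)
  have hsub : Icc (1 : ℝ) 2 ⊆ Ici 0 := Icc_subset_Ici_self.trans (Ici_subset_Ici.2 zero_le_one)
  obtain ⟨K, hK⟩ := isCompact_Icc.exists_bound_of_continuousOn
    ((h.continuousOn_snd_Ici.mono hsub).mul
      (Complex.continuous_conj.comp_continuousOn (h.continuousOn_Ici.mono hsub)))
  set ε : ℝ := (2 * (C + 1))⁻¹
  have hε : 0 < ε := by positivity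
  have hCε : C * ε ≤ 1 / 2 := by
    rw [← div_eq_mul_inv, div_le_div_iff₀ (by positivity) (by norm_num)]
    linarith
  refine ⟨2 * (1 + K + (|z.re| + C * (1 + ε⁻¹)) * ∫ t in Ioi 0, ‖u t‖ ^ 2), fun Y hY hre => ?_⟩
  obtain ⟨X, n, hX, rfl⟩ : ∃ X, ∃ n : ℕ, X ∈ Icc (1 : ℝ) 2 ∧ Y = X + n := by
    refine ⟨Y - ⌊Y - 1⌋₊, ⌊Y - 1⌋₊, ⟨?_, ?_⟩, by ring⟩
    · linarith [Nat.floor_le (show 0 ≤ Y - 1 by linarith)]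
    · linarith [Nat.lt_floor_add_one (Y - 1)]
  have hX0 : 0 < X := one_pos.trans_le hX.1
  have hXY : X ≤ X + n := by simp
  have hre_X : -(v X * starRingEnd ℂ (u X)).re ≤ K :=
    (neg_le_abs _).trans ((Complex.abs_re_le_norm _).trans (hK X hX))
  have hU : ∫ t in X..X + n, ‖u t‖ ^ 2 ≤ ∫ t in Ioi 0, ‖u t‖ ^ 2 := by
    rw [intervalIntegral.integral_of_le hXY]
    exact setIntegral_mono_set (h.integrableOn_norm_sq hu) (ae_of_all _ fun x => by positivity)
      (LE.le.eventuallyLE fun y hy => hX0.trans hy.1)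
  calc ∫ t in (2 : ℝ)..X + n, ‖v t‖ ^ 2 ≤ ∫ t in X..X + n, ‖v t‖ ^ 2 :=
        intervalIntegral.integral_mono_interval hX.2 hY le_rfl (ae_of_all _ fun _ => by positivity)
          (h.intervalIntegrable_norm_sq_snd hX0.le (hX0.le.trans hXY))
    _ ≤ _ := h.integral_norm_sq_snd_le_of_mul_le_half hq hC hε hCε hX0 n
    _ ≤ _ := by
      have := mul_le_mul_of_nonneg_left hU (show 0 ≤ |z.re| + C * (1 + ε⁻¹) by positivity)
      linarith

theorem isL2AtTop_snd_of_isEssBddBelow (hbd : IsEssBddBelow q) (hq : IsIntegrableUpTo q ⊤)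
    (h : IsSolution q ⊤ z u v) (hu : IsL2AtTop u) : IsL2AtTop v := by
  obtain ⟨D, hD⟩ := exists_integral_norm_sq_snd_le hbd hq h hu
  obtain ⟨Y, hYtop, hY⟩ := exists_seq_forall_of_frequently
    ((h.frequently_re_le_one hu).and_eventually (eventually_ge_atTop 2))
  refine ⟨2, zero_le_two, integrableOn_Ioi_of_intervalIntegral_norm_bounded D 2 (fun n => ?_)
    hYtop (Eventually.of_forall fun n => ?_)⟩
  · exact (h.intervalIntegrable_norm_sq_snd zero_le_two (zero_le_two.trans (hY n).2)).1
  · simpa only [norm_pow, norm_norm] using hD (Y n) (hY n).2 (hY n).1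

theorem flux_nonneg_of_isL2AtTop (h : IsSolution q ⊤ z u v) (hq : IsIntegrableUpTo q ⊤)
    (hz : 0 < z.im) (hu : IsL2AtTop u) (hv : IsL2AtTop v) (hx : 0 ≤ x) : 0 ≤ flux u v x := by
  by_contra! hneg
  obtain ⟨R, -, hvR⟩ := hv
  have hint : IntegrableOn (fun t => ‖u t‖ ^ 2 + ‖v t‖ ^ 2) (Ioi (max 0 R)) :=
    ((h.integrableOn_norm_sq hu).mono_set (Ioi_subset_Ioi (le_max_left 0 R))).add
      (hvR.mono_set (Ioi_subset_Ioi (le_max_right 0 R)))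
  obtain ⟨y, hy, hxy⟩ := ((frequently_lt_of_integrableOn_Ioi hint
    (neg_pos.2 hneg)).and_eventually (eventually_ge_atTop x)).exists
  have hflux := h.flux_le hq hz hx hxy (EReal.coe_lt_top y)
  have hnorm : -flux u v y ≤ ‖v y‖ * ‖u y‖ := by
    rw [← RCLike.norm_conj (u y), ← norm_mul]
    exact (neg_le_abs _).trans (Complex.abs_im_le_norm _)
  nlinarith [sq_nonneg (‖u y‖ - ‖v y‖), sq_nonneg (‖u y‖ + ‖v y‖)]

end IsSolution

end EssBddBelow

section WeylSolution

variable {q : ℝ → ℝ} {z : ℂ} {u v : ℝ → ℂ} {b x : ℝ} {e : EndCondition}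

theorem IsLocallyL1.isIntegrableUpTo (hq : IsLocallyL1 q) : IsIntegrableUpTo q ⊤ := fun X =>
  (hq (max X 1) (by positivity)).mono_set fun _ hx => ⟨hx.1, hx.2.1.trans_le (le_max_left _ _)⟩

theorem EndCondition.Admissible.isIntegrableUpTo (he : e.Admissible q) :
    IsIntegrableUpTo q e.endpoint := by
  cases e with
  | finite b h => exact fun X => he.2.mono_set fun x hx => ⟨hx.1, EReal.coe_lt_coe_iff.1 hx.2.2⟩
  | squareIntegrable => exact IsLocallyL1.isIntegrableUpTo he.1
  | limitCircle u₀ v₀ => exact IsLocallyL1.isIntegrableUpTo he.1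

namespace IsSolution

theorem exists_tendsto (h : IsSolution q b z u v) (hq : IsIntegrableUpTo q b) (hb : 0 < b) :
    ∃ l l' : ℂ, Tendsto u (𝓝[<] b) (𝓝 l) ∧ Tendsto v (𝓝[<] b) (𝓝 l') := by
  obtain ⟨u₁, v₁, h₁, hu₁, hv₁, hu0, hv0⟩ := exists_isSolution hq z (u 0, v 0)
  have heq : ∀ᶠ x in 𝓝[<] b, u₁ x = u x ∧ v₁ x = v x := by
    filter_upwards [Ioo_mem_nhdsLT hb] with x hx
    exact eq_of_eq_at_zero hq h₁ h hu0 hv0 hx.1.le (EReal.coe_lt_coe_iff.2 hx.2)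
  have hlim {f : ℝ → ℂ} (hf : ContinuousOn f (Ici 0)) : Tendsto f (𝓝[<] b) (𝓝 (f b)) :=
    (hf.continuousAt (Ici_mem_nhds hb)).mono_left nhdsWithin_le_nhds
  exact ⟨u₁ b, v₁ b, (hlim hu₁).congr' (heq.mono fun x hx => hx.1),
    (hlim hv₁).congr' (heq.mono fun x hx => hx.2)⟩

theorem flux_nonneg_of_finite {c : OnePoint ℝ} (h : IsSolution q b z u v)
    (hq : IsIntegrableUpTo q b) (hz : 0 < z.im) (hu : (EndCondition.finite b c).Holds u v)
    (hx : 0 ≤ x) (hxb : x < b) : 0 ≤ flux u v x := by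
  obtain ⟨l, l', hl, hl'⟩ := h.exists_tendsto hq (hx.trans_lt hxb)
  have hflux : Tendsto (flux u v) (𝓝[<] b) (𝓝 (l' * starRingEnd ℂ l).im) :=
    (Complex.continuous_im.tendsto _).comp
      (hl'.mul ((Complex.continuous_conj.tendsto l).comp hl))
  have hzero : (l' * starRingEnd ℂ l).im = 0 := by
    rcases c with _ | c
    · have hl0 : l = 0 := tendsto_nhds_unique hl hu
      simp [hl0]
    · have hbc : l' + c * l = 0 := tendsto_nhds_unique (hl'.add (hl.const_mul (c : ℂ))) hu
      rw [eq_neg_of_add_eq_zero_left hbc, neg_mul, mul_assoc, Complex.mul_conj,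
        ← Complex.ofReal_mul, ← Complex.ofReal_neg, Complex.ofReal_im]
  rw [hzero] at hflux
  refine le_of_tendsto hflux ?_
  filter_upwards [Ioo_mem_nhdsLT hxb] with y hy
  exact h.flux_le hq hz hx hy.1.le (EReal.coe_lt_coe_iff.2 hy.2)

end IsSolution

theorem exists_isWeylSolution_finite (hq : IsIntegrableUpTo q b) (hb : 0 < b) (h : OnePoint ℝ)
    (z : ℂ) : ∃ p, IsWeylSolution q (.finite b h) z p := by
  have hbpos : 0 < (b : EReal) := EReal.coe_pos.2 hb
  rcases h with _ | h
  · obtain ⟨u, v, hsol, hne, hu, -, h0⟩ := exists_isSolution_boundary hq hbpos z 0 1 hb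
    rw [zero_mul, zero_add, one_mul] at h0
    have hlim : Tendsto u (𝓝[<] b) (𝓝 0) := h0 ▸ hu.tendsto.mono_left nhdsWithin_le_nhds
    exact ⟨(u, v), hsol, hne, hlim⟩
  · obtain ⟨u, v, hsol, hne, hu, hv, h0⟩ := exists_isSolution_boundary hq hbpos z 1 h hb
    rw [one_mul] at h0
    have hlim : Tendsto (fun x => v x + h * u x) (𝓝[<] b) (𝓝 0) :=
      h0 ▸ (hv.add (continuousAt_const.mul hu)).tendsto.mono_left nhdsWithin_le_nhds
    exact ⟨(u, v), hsol, hne, hlim⟩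

theorem exists_isWeylSolution_limitCircle {u₀ v₀ : ℝ → ℂ} (hlc : IsLimitCircle q)
    (hq : IsIntegrableUpTo q ⊤) (h₀ : IsSolution q ⊤ Complex.I u₀ v₀) (hz : 0 < z.im) :
    ∃ p, IsWeylSolution q (.limitCircle u₀ v₀) z p := by
  obtain ⟨c, c', s, s', hc, hs, -, hne⟩ := exists_fundamentalSystem hq EReal.zero_lt_top z
  have hL2₀ := hlc Complex.I (by simp) u₀ v₀ h₀
  obtain ⟨l, hl⟩ := IsSolution.exists_tendsto_wronskian hq h₀ hc hL2₀ (hlc z hz _ _ hc)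
  obtain ⟨l', hl'⟩ := IsSolution.exists_tendsto_wronskian hq h₀ hs hL2₀ (hlc z hz _ _ hs)
  obtain ⟨w, hw, h0⟩ := exists_norm_eq_one_mul_add_mul_eq_zero l l'
  refine ⟨(_, _), IsSolution.lincomb hq hc hs w.1 w.2, hne w hw, ?_⟩
  refine (h0 ▸ (hl.const_mul w.1).add (hl'.const_mul w.2)).congr fun x => ?_
  ring

theorem exists_isWeylSolution (he : e.Admissible q) (hz : 0 < z.im) :
    ∃ p, IsWeylSolution q e z p := by
  have hq := he.isIntegrableUpTo
  cases e with
  | finite b h => exact exists_isWeylSolution_finite hq he.1 h z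
  | squareIntegrable =>
    obtain ⟨u, v, h, hne, hL2⟩ := IsSolution.exists_isL2AtTop hq hz
    exact ⟨(u, v), h, hne, hL2⟩
  | limitCircle u₀ v₀ => exact exists_isWeylSolution_limitCircle he.2.1 hq he.2.2.1 hz

theorem IsWeylSolution.flux_nonneg {p : (ℝ → ℂ) × (ℝ → ℂ)} (hp : IsWeylSolution q e z p)
    (he : e.Admissible q) (hz : 0 < z.im) (hx : 0 ≤ x) (hxb : (x : EReal) < e.endpoint) :
    0 ≤ flux p.1 p.2 x := by
  have hq := he.isIntegrableUpTo
  obtain ⟨h, -, hholds⟩ := hp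
  cases e with
  | finite b c => exact h.flux_nonneg_of_finite hq hz hholds hx (EReal.coe_lt_coe_iff.1 hxb)
  | squareIntegrable =>
    rcases he.2 with hbd | hlp
    · exact h.flux_nonneg_of_isL2AtTop hq hz hholds
        (IsSolution.isL2AtTop_snd_of_isEssBddBelow hbd hq h hholds) hx
    · exact IsSolution.flux_nonneg_of_isLimitPoint hlp hq h hz hholds hx
  | limitCircle u₀ v₀ =>
    obtain ⟨-, hlc, h₀, hne₀, hsa⟩ := he
    exact IsSolution.flux_nonneg_of_isLimitCircle hlc hq h₀ hne₀ hsa h hz hholds hx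

end WeylSolution

section APriori

variable {q : ℝ → ℝ} {b : EReal} {κ : ℂ} {u v : ℝ → ℂ} {x y a c r L : ℝ}

theorem norm_exp_mul_ofReal (κ : ℂ) (x : ℝ) : ‖Complex.exp (κ * x)‖ = Real.exp (κ.re * x) := by
  rw [Complex.norm_exp, Complex.re_mul_ofReal]

theorem norm_integral_le_integral_abs_mul {g : ℝ → ℂ} {B : ℝ} (hxy : x ≤ y)
    (hq : IntervalIntegrable q volume x y) (hg : ∀ t ∈ Icc x y, ‖g t‖ ≤ |q t| * B) :
    ‖∫ t in x..y, g t‖ ≤ (∫ t in x..y, |q t|) * B :=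
  (intervalIntegral.norm_integral_le_of_norm_le hxy
    (ae_of_all _ fun t ht => hg t ⟨ht.1.le, ht.2⟩) (hq.abs.mul_const B)).trans_eq
    (intervalIntegral.integral_mul_const _ _)

theorem IsPrimitiveOn.norm_le_two_mul {E : Type*} [NormedAddCommGroup E] [NormedSpace ℝ E]
    {F f : ℝ → E} {g : ℝ → ℝ} (h : IsPrimitiveOn F f x y) (hg : IntervalIntegrable g volume x y)
    (hg0 : ∀ t, 0 ≤ g t) (hg1 : ∫ t in x..y, g t ≤ 1 / 2)
    (hf : ∀ t ∈ Icc x y, ‖f t‖ ≤ g t * ‖F t‖) {t : ℝ} (ht : t ∈ Icc x y) :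
    ‖F t‖ ≤ 2 * ‖F x‖ := by
  have hxy := ht.1.trans ht.2
  obtain ⟨m, hm, hmax⟩ := isCompact_Icc.exists_isMaxOn (nonempty_Icc.2 hxy)
    (uIcc_of_le hxy ▸ h.continuousOn.norm)
  have hgm : IntervalIntegrable g volume x m :=
    hg.mono_set (uIcc_subset_uIcc_left (Icc_subset_uIcc hm))
  have hgrowth : ‖F m‖ - ‖F x‖ ≤ 1 / 2 * ‖F m‖ :=
    calc ‖F m‖ - ‖F x‖ ≤ ‖∫ t in x..m, f t‖ := by
          rw [← h.sub_eq left_mem_uIcc (Icc_subset_uIcc hm)]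
          exact norm_sub_norm_le _ _
      _ ≤ ∫ t in x..m, g t * ‖F m‖ := by
          refine intervalIntegral.norm_integral_le_of_norm_le hm.1 (ae_of_all _ fun s hs => ?_)
            (hgm.mul_const _)
          have hsy : s ∈ Icc x y := ⟨hs.1.le, hs.2.trans hm.2⟩
          exact (hf s hsy).trans (mul_le_mul_of_nonneg_left (hmax hsy) (hg0 s))
      _ = (∫ t in x..m, g t) * ‖F m‖ := intervalIntegral.integral_mul_const _ _
      _ ≤ 1 / 2 * ‖F m‖ := by
          gcongr
          exact (intervalIntegral.integral_mono_interval le_rfl hm.1 hm.2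
            (ae_of_all _ hg0) hg).trans hg1
  have htm : ‖F t‖ ≤ ‖F m‖ := hmax ht
  linarith

-- If `Im (w ȳ) ≥ 0`, then `-Im κ |y|² ≤ Im ((w - κ y) ȳ)`.
theorem norm_mul_norm_le_of_im_nonneg {w y : ℂ} (hL : ‖κ‖ ≤ L * -κ.im) (hκ : κ.im < 0)
    (him : 0 ≤ (w * starRingEnd ℂ y).im) : ‖κ‖ * ‖y‖ ≤ L * ‖w - κ * y‖ := by
  have hL0 : 0 ≤ L := nonneg_of_mul_nonneg_left ((norm_nonneg κ).trans hL) (neg_pos.2 hκ)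
  have him_le : -κ.im * ‖y‖ ≤ ‖w - κ * y‖ := by
    rcases eq_or_ne y 0 with rfl | hy
    · simp
    refine le_of_mul_le_mul_right ?_ (norm_pos_iff.2 hy)
    have him_eq : ((w - κ * y) * starRingEnd ℂ y).im =
        (w * starRingEnd ℂ y).im - κ.im * ‖y‖ ^ 2 := by
      rw [sub_mul, mul_assoc, Complex.mul_conj, Complex.normSq_eq_norm_sq, Complex.sub_im,
        Complex.im_mul_ofReal]
    have hnorm := (le_abs_self _).trans
      (Complex.abs_im_le_norm ((w - κ * y) * starRingEnd ℂ y))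
    rw [norm_mul, RCLike.norm_conj] at hnorm
    linarith
  calc ‖κ‖ * ‖y‖ ≤ L * -κ.im * ‖y‖ := by gcongr
    _ = L * (-κ.im * ‖y‖) := mul_assoc _ _ _
    _ ≤ L * ‖w - κ * y‖ := by gcongr

theorem norm_add_le_of_im_nonneg {w y : ℂ} (hL : ‖κ‖ ≤ L * -κ.im) (hκ : κ.im < 0)
    (him : 0 ≤ (w * starRingEnd ℂ y).im) : ‖w + κ * y‖ ≤ (1 + 2 * L) * ‖w - κ * y‖ := by
  have hy := norm_mul_norm_le_of_im_nonneg hL hκ him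
  have hsplit : w + κ * y = (w - κ * y) + 2 * (κ * y) := by ring
  have htri := norm_add_le (w - κ * y) (2 * (κ * y))
  rw [← hsplit, norm_mul, norm_mul, Complex.norm_two] at htri
  linarith

theorem exp_mul_self_le (hL : 0 < L) (hac : a < c) (hxa : x ≤ a) (hκ : 0 < ‖κ‖)
    (hre : ‖κ‖ ≤ L * κ.re) :
    Real.exp (-κ.re * (c - x)) * Real.exp (-κ.re * (c - x)) ≤ L / (2 * (c - a) * ‖κ‖) := by
  have : 0 < c - a := sub_pos.2 hac
  have : 0 < κ.re := pos_of_mul_pos_right (hκ.trans_le hre) hL.le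
  have hlin := Real.add_one_le_exp (2 * κ.re * (c - x))
  rw [← Real.exp_add, show -κ.re * (c - x) + -κ.re * (c - x) = -(2 * κ.re * (c - x)) by ring,
    Real.exp_neg]
  refine inv_le_of_inv_le₀ (by positivity) ?_
  rw [inv_div, div_le_iff₀ hL]
  calc 2 * (c - a) * ‖κ‖ ≤ 2 * (c - x) * (L * κ.re) := by gcongr; linarith
    _ = 2 * κ.re * (c - x) * L := by ring
    _ ≤ Real.exp (2 * κ.re * (c - x)) * L := by gcongr; linarith

theorem norm_add_le_of_norm_add_le_norm_sub {w y : ℂ} {E : ℝ} (hκ : 0 < ‖κ‖) (hE : 2 * E ≤ ‖κ‖)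
    (hw : ‖w + κ * y‖ ≤ E / ‖κ‖ * ‖w - κ * y‖) (hE0 : 0 ≤ E) : ‖w + κ * y‖ ≤ 4 * E * ‖y‖ := by
  have hsplit : w - κ * y = (w + κ * y) - 2 * (κ * y) := by ring
  have htri := norm_sub_le (w + κ * y) (2 * (κ * y))
  rw [← hsplit, norm_mul, norm_mul, Complex.norm_two] at htri
  have hhalf : E / ‖κ‖ * ‖w + κ * y‖ ≤ 1 / 2 * ‖w + κ * y‖ := by
    refine mul_le_mul_of_nonneg_right ?_ (norm_nonneg _)
    rw [div_le_iff₀ hκ]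
    linarith
  have hcancel : E / ‖κ‖ * (2 * (‖κ‖ * ‖y‖)) = 2 * E * ‖y‖ := by field_simp
  have hmul := mul_le_mul_of_nonneg_left htri (div_nonneg hE0 hκ.le)
  linarith

namespace IsSolution

theorem primitive_exp_neg_mul (h : IsSolution q b (-κ ^ 2) u v) (hq : IsIntegrableUpTo q b)
    {X : ℝ} (hX : 0 ≤ X) (hXb : (X : EReal) < b) :
    IsPrimitiveOn (fun x => Complex.exp (-κ * x) * (v x + κ * u x))
      (fun x => Complex.exp (-κ * x) * (q x * u x)) 0 X := by
  refine (((h.primitive_snd hq hX hXb).add ((h.primitive_fst hX hXb).const_mul κ)).exp_mul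
    (-κ)).congr_right fun x _ => ?_
  ring

theorem primitive_exp_mul (h : IsSolution q b (-κ ^ 2) u v) (hq : IsIntegrableUpTo q b) {X : ℝ}
    (hX : 0 ≤ X) (hXb : (X : EReal) < b) :
    IsPrimitiveOn (fun x => Complex.exp (κ * x) * (v x - κ * u x))
      (fun x => Complex.exp (κ * x) * (q x * u x)) 0 X := by
  refine (((h.primitive_snd hq hX hXb).sub ((h.primitive_fst hX hXb).const_mul κ)).exp_mul
    κ).congr_right fun x _ => ?_
  ring

theorem norm_sub_le_two_mul_exp (h : IsSolution q b (-κ ^ 2) u v) (hq : IsIntegrableUpTo q b)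
    (hx : 0 ≤ x) (hcb : (c : EReal) < b) (hu : ∀ t ∈ Icc x c, ‖u t‖ ≤ r * ‖v t - κ * u t‖)
    (hr : (∫ t in x..c, |q t|) * r ≤ 1 / 2) (hr0 : 0 ≤ r) {t : ℝ} (ht : t ∈ Icc x c) :
    ‖v t - κ * u t‖ ≤ 2 * Real.exp (-κ.re * (t - x)) * ‖v x - κ * u x‖ := by
  have hxc := ht.1.trans ht.2
  have hqx := (hq.intervalIntegrable (hx.trans hxc) hcb).mono_set
    (uIcc_subset_uIcc (Icc_subset_uIcc ⟨hx, hxc⟩) right_mem_uIcc)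
  have hp := (h.primitive_exp_mul hq (hx.trans hxc) hcb).mono
    (Icc_subset_uIcc ⟨hx, hxc⟩) right_mem_uIcc
  have hgrowth := hp.norm_le_two_mul (hqx.abs.mul_const r)
    (fun _ => mul_nonneg (abs_nonneg _) hr0) (by rwa [intervalIntegral.integral_mul_const])
    (fun s hs => ?_) ht
  · rw [norm_mul, norm_mul, norm_exp_mul_ofReal, norm_exp_mul_ofReal] at hgrowth
    rw [mul_sub, Real.exp_sub, neg_mul, neg_mul, Real.exp_neg, Real.exp_neg]
    field_simp
    linarith
  · calc ‖Complex.exp (κ * s) * (q s * u s)‖ = |q s| * (‖Complex.exp (κ * s)‖ * ‖u s‖) := by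
          rw [norm_mul, norm_mul, Complex.norm_real, Real.norm_eq_abs]
          ring
      _ ≤ |q s| * (‖Complex.exp (κ * s)‖ * (r * ‖v s - κ * u s‖)) := by gcongr; exact hu s hs
      _ = |q s| * r * ‖Complex.exp (κ * s) * (v s - κ * u s)‖ := by
          rw [norm_mul]
          ring

theorem norm_add_le_exp_mul_add (h : IsSolution q b (-κ ^ 2) u v) (hq : IsIntegrableUpTo q b)
    (hκ : 0 ≤ κ.re) (hx : 0 ≤ x) (hxc : x ≤ c) (hcb : (c : EReal) < b)
    (hu : ∀ t ∈ Icc x c, ‖u t‖ ≤ r * ‖v t - κ * u t‖)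
    (hr : (∫ t in x..c, |q t|) * r ≤ 1 / 2) (hr0 : 0 ≤ r) :
    ‖v x + κ * u x‖ ≤ Real.exp (-κ.re * (c - x)) * ‖v c + κ * u c‖ +
      2 * ((∫ t in x..c, |q t|) * r) * ‖v x - κ * u x‖ := by
  have hqx := (hq.intervalIntegrable (hx.trans hxc) hcb).mono_set
    (uIcc_subset_uIcc (Icc_subset_uIcc ⟨hx, hxc⟩) right_mem_uIcc)
  have hp := (h.primitive_exp_neg_mul hq (hx.trans hxc) hcb).mono
    (Icc_subset_uIcc ⟨hx, hxc⟩) right_mem_uIcc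
  set B := r * (2 * ‖v x - κ * u x‖)
  have hexp {t : ℝ} : Real.exp (-κ.re * t) = Real.exp (-κ.re * x) * Real.exp (-κ.re * (t - x)) := by
    rw [← Real.exp_add]
    ring_nf
  have hint : ‖∫ t in x..c, Complex.exp (-κ * t) * (q t * u t)‖ ≤
      (∫ t in x..c, |q t|) * (Real.exp (-κ.re * x) * B) := by
    refine norm_integral_le_integral_abs_mul hxc hqx fun t ht => ?_
    have hdecay := h.norm_sub_le_two_mul_exp hq hx hcb hu hr hr0 ht
    have hexp_le : Real.exp (-κ.re * (t - x)) ≤ 1 :=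
      Real.exp_le_one_iff.2 (by nlinarith [ht.1])
    calc ‖Complex.exp (-κ * t) * (q t * u t)‖ = |q t| * (Real.exp (-κ.re * t) * ‖u t‖) := by
          rw [norm_mul, norm_mul, norm_exp_mul_ofReal, Complex.norm_real, Real.norm_eq_abs,
            Complex.neg_re]
          ring
      _ ≤ |q t| * (Real.exp (-κ.re * x) * 1 * (r * (2 * 1 * ‖v x - κ * u x‖))) := by
          rw [hexp]
          gcongr
          exact (hu t ht).trans (by gcongr; exact hdecay.trans (by gcongr))
      _ = |q t| * (Real.exp (-κ.re * x) * B) := by ring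
  have hsub := norm_sub_norm_le (Complex.exp (-κ * x) * (v x + κ * u x))
    (Complex.exp (-κ * c) * (v c + κ * u c))
  rw [norm_sub_rev, hp.sub_eq left_mem_uIcc right_mem_uIcc, norm_mul, norm_mul,
    norm_exp_mul_ofReal, norm_exp_mul_ofReal, Complex.neg_re, hexp (t := c)] at hsub
  refine le_of_mul_le_mul_left ?_ (Real.exp_pos (-κ.re * x))
  linarith

-- Both `(1 + 2 L) e^(-2 κ (c - a))` and `‖κ‖⁻¹ ∫ |q|` are `O (‖κ‖⁻¹)` in the sector.
theorem norm_add_le_div_mul_norm_sub (h : IsSolution q b (-κ ^ 2) u v) (hq : IsIntegrableUpTo q b)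
    (hac : a < c) (hcb : (c : EReal) < b) (hflux : ∀ t ∈ Icc 0 c, 0 ≤ flux u v t) (hL : 0 < L)
    (him : ‖κ‖ ≤ L * -κ.im) (hre : ‖κ‖ ≤ L * κ.re) (hκ : 0 < ‖κ‖)
    (hQ : 2 * (L * ∫ t in (0 : ℝ)..c, |q t|) ≤ ‖κ‖) (hx : x ∈ Icc 0 a) :
    ‖v x + κ * u x‖ ≤
      ((1 + 2 * L) * L / (c - a) + 2 * L * ∫ t in (0 : ℝ)..c, |q t|) / ‖κ‖ * ‖v x - κ * u x‖ := by
  have hxc : x < c := hx.2.trans_lt hac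
  have hc : 0 ≤ c := hx.1.trans hxc.le
  have hre0 : 0 < κ.re := pos_of_mul_pos_right (hκ.trans_le hre) hL.le
  have him0 : κ.im < 0 := neg_pos.1 (pos_of_mul_pos_right (hκ.trans_le him) hL.le)
  set Q := ∫ t in (0 : ℝ)..c, |q t|
  have hQx : ∫ t in x..c, |q t| ≤ Q := intervalIntegral.integral_mono_interval hx.1 hxc.le le_rfl
    (ae_of_all _ fun _ => abs_nonneg _) (hq.intervalIntegrable hc hcb).abs
  have hu (t : ℝ) (ht : t ∈ Icc x c) : ‖u t‖ ≤ L / ‖κ‖ * ‖v t - κ * u t‖ := by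
    rw [div_mul_eq_mul_div, le_div_iff₀ hκ, mul_comm]
    exact norm_mul_norm_le_of_im_nonneg him him0 (hflux t ⟨hx.1.trans ht.1, ht.2⟩)
  have hr0 : 0 ≤ L / ‖κ‖ := by positivity
  have hr : (∫ t in x..c, |q t|) * (L / ‖κ‖) ≤ 1 / 2 := by
    refine (mul_le_mul_of_nonneg_right hQx hr0).trans ?_
    rw [← mul_div_assoc, div_le_iff₀ hκ]
    linarith
  set m := ‖v x - κ * u x‖
  set η := Real.exp (-κ.re * (c - x))
  have hpc : ‖v c + κ * u c‖ ≤ (1 + 2 * L) * (2 * η * m) :=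
    (norm_add_le_of_im_nonneg him him0 (hflux c ⟨hc, le_rfl⟩)).trans (by
      gcongr
      exact h.norm_sub_le_two_mul_exp hq hx.1 hcb hu hr hr0 ⟨hxc.le, le_rfl⟩)
  have hη : η * η ≤ L / (2 * (c - a) * ‖κ‖) := exp_mul_self_le hL hac hx.2 hκ hre
  calc ‖v x + κ * u x‖ ≤ η * ‖v c + κ * u c‖ + 2 * ((∫ t in x..c, |q t|) * (L / ‖κ‖)) * m :=
        h.norm_add_le_exp_mul_add hq hre0.le hx.1 hxc.le hcb hu hr hr0
    _ ≤ η * ((1 + 2 * L) * (2 * η * m)) + 2 * (Q * (L / ‖κ‖)) * m := by gcongr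
    _ = (2 * (1 + 2 * L) * (η * η) + 2 * (Q * (L / ‖κ‖))) * m := by ring
    _ ≤ (2 * (1 + 2 * L) * (L / (2 * (c - a) * ‖κ‖)) + 2 * (Q * (L / ‖κ‖))) * m := by gcongr
    _ = _ := by
      have hca : c - a ≠ 0 := (sub_pos.2 hac).ne'
      field_simp

-- A solution of nonnegative flux is nearly proportional to `e^(-κ x)`.
theorem norm_add_le_mul (h : IsSolution q b (-κ ^ 2) u v) (hq : IsIntegrableUpTo q b)
    (hac : a < c) (hcb : (c : EReal) < b) (hflux : ∀ x ∈ Icc 0 c, 0 ≤ flux u v x) (hL : 0 < L)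
    (him : ‖κ‖ ≤ L * -κ.im) (hre : ‖κ‖ ≤ L * κ.re)
    (hκ : 2 * ((1 + 2 * L) * L / (c - a) + 2 * L * ∫ t in (0 : ℝ)..c, |q t|) ≤ ‖κ‖)
    (hx : x ∈ Icc 0 a) :
    ‖v x + κ * u x‖ ≤
      4 * ((1 + 2 * L) * L / (c - a) + 2 * L * ∫ t in (0 : ℝ)..c, |q t|) * ‖u x‖ := by
  have : 0 < c - a := sub_pos.2 hac
  have hQ : 0 ≤ ∫ t in (0 : ℝ)..c, |q t| := intervalIntegral.integral_nonneg
    (hx.1.trans (hx.2.trans hac.le)) fun _ _ => abs_nonneg _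
  have hLpos : 0 < (1 + 2 * L) * L / (c - a) := by positivity
  have hLQ : 0 ≤ L * ∫ t in (0 : ℝ)..c, |q t| := by positivity
  have hκ0 : 0 < ‖κ‖ := by linarith
  exact norm_add_le_of_norm_add_le_norm_sub hκ0 hκ (h.norm_add_le_div_mul_norm_sub hq hac hcb
    hflux hL him hre hκ0 (by linarith) hx) (by positivity)

theorem norm_le_mul_exp {z : ℂ} (h : IsSolution q b z u v) {M : ℝ} (ha : 0 ≤ a)
    (hab : (a : EReal) < b) (hM : ∀ x ∈ Icc 0 a, ‖v x + κ * u x‖ ≤ M * ‖u x‖) :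
    ‖u a‖ ≤ ‖u 0‖ * Real.exp ((M - κ.re) * a) := by
  have hcont : ContinuousOn (fun x : ℝ => Complex.exp (κ * x) * u x) (Icc 0 a) := by
    have hprim := (h.primitive_fst ha hab).exp_mul κ
    simpa only [uIcc_of_le ha] using hprim.continuousOn
  have hderiv (x : ℝ) (hx : x ∈ Ico 0 a) : HasDerivWithinAt (fun x : ℝ => Complex.exp (κ * x) * u x)
      (Complex.exp (κ * x) * (v x + κ * u x)) (Ici x) x := by
    have hexp := ((Complex.ofRealCLM.hasDerivAt (x := x)).const_mul κ).cexp
    refine (hexp.hasDerivWithinAt.mul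
      (h.hasDerivWithinAt_Ici hx.1 (coe_lt_of_le hx.2.le hab))).congr_deriv ?_
    simp only [Complex.ofRealCLM_apply, Complex.ofReal_one]
    ring
  have hgronwall := norm_le_gronwallBound_of_norm_deriv_right_le (δ := ‖u 0‖) (K := M) (ε := 0)
    hcont hderiv (by simp) (fun x hx => by
      rw [norm_mul, norm_mul, add_zero, mul_left_comm]
      gcongr
      exact hM x ⟨hx.1, hx.2.le⟩) a ⟨ha, le_rfl⟩
  rw [gronwallBound_ε0, norm_mul, norm_exp_mul_ofReal, sub_zero] at hgronwall
  rwa [sub_mul, Real.exp_sub, ← mul_div_assoc, le_div_iff₀ (Real.exp_pos _), mul_comm]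

end IsSolution

end APriori

section Kernel

variable {q : ℝ → ℝ}

section ParametricIntegral

variable {X : Type*} [TopologicalSpace X] [FirstCountableTopology X] [LocallyCompactSpace X]
  {Φ : X → ℝ → ℝ}

theorem continuous_primitive_mul (hq : Integrable q) (hΦ : Continuous (Function.uncurry Φ)) :
    Continuous fun w : X × ℝ => ∫ y in (0 : ℝ)..w.2, q y * Φ w.1 y := by
  rw [continuous_iff_continuousAt]
  rintro ⟨p₀, r₀⟩
  obtain ⟨K, hK, hKp⟩ := exists_compact_mem_nhds p₀
  set R := |r₀| + 1
  have hr₀ := abs_lt.1 (by simp [R] : |r₀| < R)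
  have hR : 0 < R := by positivity
  obtain ⟨C, hC⟩ := (hK.prod (isCompact_Icc (a := -R) (b := R))).exists_bound_of_continuousOn
    hΦ.continuousOn
  refine intervalIntegral.continuousAt_parametric_primitive_of_dominated
    (F := fun p y => q y * Φ p y) (fun y => |q y| * C) (-R) R
    (fun p => (hq.aestronglyMeasurable.mul (hΦ.uncurry_left p).aestronglyMeasurable).restrict)
    ?_ (hq.abs.mul_const C).intervalIntegrable ?_ ⟨by linarith, hR⟩ hr₀ (by simp)
  · filter_upwards [hKp] with p hp
    rw [ae_restrict_iff' measurableSet_uIoc]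
    refine ae_of_all _ fun y hy => ?_
    rw [uIoc_of_le (by linarith)] at hy
    rw [norm_mul, Real.norm_eq_abs]
    gcongr
    exact hC (p, y) ⟨hp, hy.1.le, hy.2⟩
  · exact ae_of_all _ fun y => continuousAt_const.mul (hΦ.uncurry_right y).continuousAt

theorem continuous_integral_mul (hq : Integrable q) (hΦ : Continuous (Function.uncurry Φ))
    {l r : X → ℝ} (hl : Continuous l) (hr : Continuous r) :
    Continuous fun p => ∫ y in l p..r p, q y * Φ p y := by
  have hint : ∀ p x y, IntervalIntegrable (fun t => q t * Φ p t) volume x y := fun p x y =>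
    hq.intervalIntegrable.mul_continuousOn (hΦ.uncurry_left p).continuousOn
  have hsub : (fun p => ∫ y in l p..r p, q y * Φ p y) = fun p =>
      (∫ y in (0 : ℝ)..r p, q y * Φ p y) - ∫ y in (0 : ℝ)..l p, q y * Φ p y := by
    funext p
    rw [intervalIntegral.integral_interval_sub_left (hint _ _ _) (hint _ _ _)]
  rw [hsub]
  exact ((continuous_primitive_mul hq hΦ).comp (continuous_id.prodMk hr)).sub
    ((continuous_primitive_mul hq hΦ).comp (continuous_id.prodMk hl))

end ParametricIntegral

theorem abs_integral_mul_le (hq : Integrable q) {g : ℝ → ℝ} {x y B : ℝ} (hB : 0 ≤ B)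
    (hg : ∀ t ∈ uIoc x y, |g t| ≤ B) : |∫ t in x..y, q t * g t| ≤ (∫ t, |q t|) * B := by
  rw [← Real.norm_eq_abs]
  calc ‖∫ t in x..y, q t * g t‖ ≤ ∫ t in uIoc x y, ‖q t * g t‖ :=
        intervalIntegral.norm_integral_le_integral_norm_uIoc
    _ ≤ ∫ t in uIoc x y, |q t| * B := by
        refine integral_mono_of_nonneg (ae_of_all _ fun t => norm_nonneg _)
          (hq.abs.mul_const B).integrableOn
          (ae_restrict_of_forall_mem measurableSet_uIoc fun t ht => ?_)
        beta_reduce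
        rw [norm_mul, Real.norm_eq_abs, Real.norm_eq_abs]
        gcongr
        exact hg t ht
    _ ≤ ∫ t, |q t| * B := setIntegral_le_integral (hq.abs.mul_const B)
        (ae_of_all _ fun t => by positivity)
    _ = (∫ t, |q t|) * B := integral_mul_const _ _

/-- The terms of the Neumann series of the transformation kernel `transKernel`. -/
noncomputable def kernelTerm (q : ℝ → ℝ) : ℕ → ℝ → ℝ → ℝ
  | 0 => fun x η => -(1 / 2) * ∫ y in η..(x + η), q y
  | n + 1 => fun x η => -∫ s in (0 : ℝ)..η, ∫ y in s..(x + s), q y * kernelTerm q n y (η - s)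

theorem continuous_integral_mul_sub (hq : Integrable q) {V : ℝ → ℝ → ℝ}
    (hV : Continuous (Function.uncurry V)) :
    Continuous fun w : (ℝ × ℝ) × ℝ => ∫ y in w.2..(w.1.1 + w.2), q y * V y (w.1.2 - w.2) :=
  continuous_integral_mul hq (Φ := fun (w : (ℝ × ℝ) × ℝ) y => V y (w.1.2 - w.2))
    (hV.comp (by fun_prop : Continuous fun p : ((ℝ × ℝ) × ℝ) × ℝ => (p.2, p.1.1.2 - p.1.2)))
    (by fun_prop) (by fun_prop)

theorem continuous_kernelTerm (hq : Integrable q) (n : ℕ) :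
    Continuous (Function.uncurry (kernelTerm q n)) := by
  induction n with
  | zero =>
    have hint := continuous_integral_mul (X := ℝ × ℝ) hq (Φ := fun _ _ => 1) continuous_const
      (l := fun p => p.2) (r := fun p => p.1 + p.2) (by fun_prop) (by fun_prop)
    simp only [mul_one] at hint
    exact continuous_const.mul hint
  | succ n ih =>
    exact (intervalIntegral.continuous_parametric_intervalIntegral_of_continuous
      (f := fun (w : ℝ × ℝ) s => ∫ y in s..(w.1 + s), q y * kernelTerm q n y (w.2 - s))
      (continuous_integral_mul_sub hq ih) continuous_snd).neg

theorem abs_kernelTerm_le (hq : Integrable q) (n : ℕ) (x η : ℝ) :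
    |kernelTerm q n x η| ≤ (∫ t, |q t|) / 2 * (((∫ t, |q t|) * |η|) ^ n / n.factorial) := by
  have hQ : 0 ≤ ∫ t, |q t| := integral_nonneg fun _ => abs_nonneg _
  induction n generalizing x η with
  | zero =>
    have hint := abs_integral_mul_le hq (g := fun _ => 1) (x := η) (y := x + η) zero_le_one
      (fun t _ => by simp)
    simp only [mul_one] at hint
    simp only [kernelTerm, abs_mul, abs_neg]
    norm_num
    linarith
  | succ n ih =>
    set Q := ∫ t, |q t|
    simp only [kernelTerm, abs_neg]
    calc _ ≤ ∫ s in uIoc 0 η, ‖∫ y in s..(x + s), q y * kernelTerm q n y (η - s)‖ :=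
          intervalIntegral.norm_integral_le_integral_norm_uIoc
      _ ≤ ∫ s in uIoc η 0, Q * Q / 2 * (Q ^ n / n.factorial) * |s - η| ^ n := by
          rw [uIoc_comm]
          refine integral_mono_of_nonneg (ae_of_all _ fun s => norm_nonneg _)
            (Continuous.intervalIntegrable (by fun_prop) η 0).def' (ae_of_all _ fun s => ?_)
          refine (abs_integral_mul_le hq (g := fun y => kernelTerm q n y (η - s)) (x := s)
            (y := x + s) (by positivity) (fun t _ => ih t (η - s))).trans_eq ?_
          rw [abs_sub_comm, mul_pow]
          ring
      _ = Q * Q / 2 * (Q ^ n / n.factorial) * (|η| ^ (n + 1) / (n + 1)) := by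
          rw [integral_const_mul, integral_pow_abs_sub_uIoc, zero_sub, abs_neg]
      _ = Q / 2 * ((Q * |η|) ^ (n + 1) / (n + 1).factorial) := by
          rw [Nat.factorial_succ, mul_pow]
          push_cast
          field_simp
          ring

theorem abs_kernelTerm_le_of_abs_le (hq : Integrable q) (n : ℕ) (x : ℝ) {η R : ℝ}
    (hη : |η| ≤ R) :
    |kernelTerm q n x η| ≤ (∫ t, |q t|) / 2 * (((∫ t, |q t|) * R) ^ n / n.factorial) := by
  have : 0 ≤ ∫ t, |q t| := integral_nonneg fun _ => abs_nonneg _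
  refine (abs_kernelTerm_le hq n x η).trans ?_
  gcongr

/-- The kernel `V` of the transformation operator: for integrable `q` and `κ` with large real part,
`exp (-κ x) (1 + 2 ∫₀^∞ V x η exp (-2 κ η) dη)` is the solution of `-u'' + q u = -κ² u` with
`u 0 = 1` that decays at infinity. -/
noncomputable def transKernel (q : ℝ → ℝ) (x η : ℝ) : ℝ := ∑' n, kernelTerm q n x η

theorem hasSum_kernelTerm (hq : Integrable q) (x η : ℝ) :
    HasSum (fun n => kernelTerm q n x η) (transKernel q x η) :=
  (Summable.of_norm_bounded ((Real.summable_pow_div_factorial _).mul_left _)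
    (fun n => abs_kernelTerm_le hq n x η)).hasSum

theorem abs_transKernel_le (hq : Integrable q) (x η : ℝ) :
    |transKernel q x η| ≤ (∫ t, |q t|) / 2 * Real.exp ((∫ t, |q t|) * |η|) := by
  have hexp : HasSum (fun n : ℕ => ((∫ t, |q t|) * |η|) ^ n / n.factorial)
      (Real.exp ((∫ t, |q t|) * |η|)) := by
    rw [Real.exp_eq_exp_ℝ]
    exact NormedSpace.expSeries_div_hasSum_exp _
  rw [← Real.norm_eq_abs]
  exact tsum_of_norm_bounded (hexp.mul_left _) fun n => abs_kernelTerm_le hq n x η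

theorem continuous_transKernel (hq : Integrable q) :
    Continuous (Function.uncurry (transKernel q)) := by
  rw [continuous_iff_continuousAt]
  rintro ⟨x, η⟩
  have hnhds : {p : ℝ × ℝ | |p.2| < |η| + 1} ∈ 𝓝 (x, η) :=
    (isOpen_lt (by fun_prop) continuous_const).mem_nhds (by simp)
  exact (continuousOn_tsum (f := fun n => Function.uncurry (kernelTerm q n))
    (fun n => (continuous_kernelTerm hq n).continuousOn)
    ((Real.summable_pow_div_factorial _).mul_left _)
    fun n p hp => abs_kernelTerm_le_of_abs_le hq n p.1 (le_of_lt hp)).continuousAt hnhds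

theorem hasSum_integral_mul_kernelTerm (hq : Integrable q) (x y η : ℝ) :
    HasSum (fun n => ∫ t in x..y, q t * kernelTerm q n t η)
      (∫ t in x..y, q t * transKernel q t η) := by
  refine intervalIntegral.hasSum_integral_of_dominated_convergence
    (fun n t => |q t| * ((∫ t, |q t|) / 2 * (((∫ t, |q t|) * |η|) ^ n / n.factorial)))
    (fun n => ?_) (fun n => ae_of_all _ fun t _ => ?_)
    (ae_of_all _ fun t _ => ((Real.summable_pow_div_factorial _).mul_left _).mul_left _) ?_
    (ae_of_all _ fun t _ => (hasSum_kernelTerm hq t η).mul_left _)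
  · exact (hq.aestronglyMeasurable.mul
      ((continuous_kernelTerm hq n).uncurry_right η).aestronglyMeasurable).restrict
  · rw [norm_mul, Real.norm_eq_abs]
    gcongr
    exact abs_kernelTerm_le hq n t η
  · simp_rw [tsum_mul_left]
    exact (hq.abs.mul_const _).intervalIntegrable

theorem hasSum_integral_integral_mul_kernelTerm (hq : Integrable q) (x η : ℝ) :
    HasSum (fun n => ∫ s in (0 : ℝ)..η, ∫ y in s..(x + s), q y * kernelTerm q n y (η - s))
      (∫ s in (0 : ℝ)..η, ∫ y in s..(x + s), q y * transKernel q y (η - s)) := by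
  have : 0 ≤ ∫ t, |q t| := integral_nonneg fun _ => abs_nonneg _
  refine intervalIntegral.hasSum_integral_of_dominated_convergence
    (fun n _ => (∫ t, |q t|) * ((∫ t, |q t|) / 2 * (((∫ t, |q t|) * |η|) ^ n / n.factorial)))
    (fun n => ?_) (fun n => ae_of_all _ fun s hs => ?_)
    (ae_of_all _ fun s _ => ((Real.summable_pow_div_factorial _).mul_left _).mul_left _)
    intervalIntegrable_const
    (ae_of_all _ fun s _ => hasSum_integral_mul_kernelTerm hq s (x + s) (η - s))
  · exact ((continuous_integral_mul_sub hq (continuous_kernelTerm hq n)).comp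
      (Continuous.prodMk_right (x, η))).aestronglyMeasurable
  · have hηs : |η - s| ≤ |η| := by
      simpa only [sub_zero] using abs_sub_right_of_mem_uIcc (uIoc_subset_uIcc hs)
    exact abs_integral_mul_le hq (by positivity) fun y _ => abs_kernelTerm_le_of_abs_le hq n y hηs

theorem transKernel_eq (hq : Integrable q) (x η : ℝ) :
    transKernel q x η = -(1 / 2) * (∫ y in η..(x + η), q y) -
      ∫ s in (0 : ℝ)..η, ∫ y in s..(x + s), q y * transKernel q y (η - s) := by
  have hsum : HasSum (fun n => kernelTerm q n x η) _ :=
    HasSum.zero_add (hasSum_integral_integral_mul_kernelTerm hq x η).neg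
  rw [(hasSum_kernelTerm hq x η).unique hsum, sub_eq_add_neg]
  rfl

theorem kernelTerm_congr {q' : ℝ → ℝ} {a : ℝ} (h : ∀ y ∈ Icc 0 a, q y = q' y) (n : ℕ) {x η : ℝ}
    (hx : 0 ≤ x) (hη : 0 ≤ η) (hxη : x + η ≤ a) : kernelTerm q n x η = kernelTerm q' n x η := by
  induction n generalizing x η with
  | zero =>
    simp only [kernelTerm]
    congr 1
    refine intervalIntegral.integral_congr fun y hy => h y ?_
    rw [uIcc_of_le (by linarith)] at hy
    exact ⟨hη.trans hy.1, hy.2.trans hxη⟩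
  | succ n ih =>
    simp only [kernelTerm]
    congr 1
    refine intervalIntegral.integral_congr fun s hs => ?_
    rw [uIcc_of_le hη] at hs
    refine intervalIntegral.integral_congr fun y hy => ?_
    rw [uIcc_of_le (by linarith)] at hy
    obtain ⟨⟨hs0, hsη⟩, hsy, hyx⟩ := hs, hy
    rw [h y ⟨by linarith, by linarith⟩, ih (by linarith) (by linarith) (by linarith)]

/-- The `A`-function of an integrable potential. -/
noncomputable def amplitude (q : ℝ → ℝ) (α : ℝ) : ℝ :=
  q α + 2 * ∫ s in (0 : ℝ)..α, q s * transKernel q s (α - s)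

theorem amplitude_congr {q' : ℝ → ℝ} {a α : ℝ} (h : ∀ y ∈ Icc 0 a, q y = q' y)
    (hα : α ∈ Icc 0 a) : amplitude q α = amplitude q' α := by
  simp only [amplitude, transKernel]
  rw [h α hα]
  congr 2
  refine intervalIntegral.integral_congr fun s hs => ?_
  rw [uIcc_of_le hα.1] at hs
  rw [h s ⟨hs.1, hs.2.trans hα.2⟩]
  congr 1
  exact tsum_congr fun n => kernelTerm_congr h n hs.1 (by linarith [hs.2]) (by linarith [hα.2])

theorem continuous_amplitude_sub (hq : Integrable q) :
    Continuous fun α => amplitude q α - q α := by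
  simp only [amplitude, add_sub_cancel_left]
  refine continuous_const.mul (continuous_integral_mul hq
    (Φ := fun α s => transKernel q s (α - s)) ?_ continuous_const continuous_id)
  exact (continuous_transKernel hq).comp
    (by fun_prop : Continuous fun p : ℝ × ℝ => (p.2, p.1 - p.2))

theorem abs_amplitude_sub_le (hq : Integrable q) {α : ℝ} (hα : 0 ≤ α) :
    |amplitude q α - q α| ≤ (∫ t, |q t|) ^ 2 * Real.exp (α * ∫ t, |q t|) := by
  set Q := ∫ t, |q t|
  have : 0 ≤ Q := integral_nonneg fun _ => abs_nonneg _
  have hV : ∀ s ∈ uIoc 0 α, |transKernel q s (α - s)| ≤ Q / 2 * Real.exp (α * Q) := by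
    intro s hs
    rw [uIoc_of_le hα] at hs
    have hαs : |α - s| ≤ α := by
      rw [abs_of_nonneg (by linarith [hs.2])]
      linarith [hs.1]
    refine (abs_transKernel_le hq s (α - s)).trans ?_
    rw [mul_comm α]
    gcongr
  calc |amplitude q α - q α| = 2 * |∫ s in (0 : ℝ)..α, q s * transKernel q s (α - s)| := by
        rw [amplitude, add_sub_cancel_left, abs_mul, abs_two]
    _ ≤ 2 * (Q * (Q / 2 * Real.exp (α * Q))) := by
        gcongr
        exact abs_integral_mul_le hq (by positivity) hV
    _ = Q ^ 2 * Real.exp (α * Q) := by ring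

end Kernel

section Laplace

variable {q : ℝ → ℝ} {p : ℝ → ℂ} {c : ℂ} {Φ Ψ : ℝ → ℝ → ℂ}

theorem integral_indicator_quadrant (s : ℝ) :
    ∫ τ, (Ioi 0 ×ˢ Ioi 0).indicator (Function.uncurry Ψ) (s, τ) =
      (Ioi (0 : ℝ)).indicator (fun s => ∫ τ in Ioi (0 : ℝ), Ψ s τ) s := by
  by_cases hs : 0 < s
  · rw [indicator_of_mem (mem_Ioi.2 hs), ← integral_indicator measurableSet_Ioi]
    congr 1 with τ
    simp only [indicator_apply, mem_prod, mem_Ioi, hs, true_and, Function.uncurry_apply_pair]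
  · simp [hs]

theorem integral_indicator_quadrant_sub (η : ℝ) :
    ∫ s, (Ioi 0 ×ˢ Ioi 0).indicator (Function.uncurry Ψ) (s, η - s) =
      (Ioi (0 : ℝ)).indicator (fun η => ∫ s in (0 : ℝ)..η, Ψ s (η - s)) η := by
  by_cases hη : 0 < η
  · rw [indicator_of_mem (mem_Ioi.2 hη), intervalIntegral.integral_of_le hη.le,
      integral_Ioc_eq_integral_Ioo, ← integral_indicator measurableSet_Ioo]
    congr 1 with s
    simp only [indicator_apply, mem_prod, mem_Ioi, mem_Ioo, sub_pos, Function.uncurry_apply_pair]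
  · have hempty : ∀ s, ¬(0 < s ∧ s < η) := fun s hs => hη (hs.1.trans hs.2)
    simp [hη, hempty]

theorem integrable_indicator_quadrant_sub
    (hΨ : Integrable (Function.uncurry Ψ)
      ((volume.restrict (Ioi 0)).prod (volume.restrict (Ioi 0)))) :
    Integrable (fun w : ℝ × ℝ => (Ioi 0 ×ˢ Ioi 0).indicator (Function.uncurry Ψ) (w.1, w.2 - w.1))
      (volume.prod volume) := by
  refine (measurePreserving_prod_sub volume volume).integrable_comp_of_integrable
    (g := (Ioi 0 ×ˢ Ioi 0).indicator (Function.uncurry Ψ)) ?_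
  rwa [integrable_indicator_iff (measurableSet_Ioi.prod measurableSet_Ioi), IntegrableOn,
    ← Measure.prod_restrict]

theorem integrableOn_integral_triangle
    (hΨ : Integrable (Function.uncurry Ψ)
      ((volume.restrict (Ioi 0)).prod (volume.restrict (Ioi 0)))) :
    IntegrableOn (fun η => ∫ s in (0 : ℝ)..η, Ψ s (η - s)) (Ioi 0) := by
  rw [← integrable_indicator_iff measurableSet_Ioi]
  exact (integrable_indicator_quadrant_sub hΨ).integral_prod_right.congr
    (ae_of_all _ integral_indicator_quadrant_sub)

theorem integral_Ioi_integral_triangle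
    (hΨ : Integrable (Function.uncurry Ψ)
      ((volume.restrict (Ioi 0)).prod (volume.restrict (Ioi 0)))) :
    ∫ η in Ioi (0 : ℝ), ∫ s in (0 : ℝ)..η, Ψ s (η - s) =
      ∫ s in Ioi (0 : ℝ), ∫ τ in Ioi (0 : ℝ), Ψ s τ := by
  rw [← integral_indicator measurableSet_Ioi, ← integral_indicator measurableSet_Ioi]
  simp_rw [← integral_indicator_quadrant_sub, ← integral_indicator_quadrant]
  rw [← integral_integral_swap (integrable_indicator_quadrant_sub hΨ)]
  exact integral_congr_ae (ae_of_all _ fun s => integral_sub_right_eq_self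
    (fun τ => (Ioi 0 ×ˢ Ioi 0).indicator (Function.uncurry Ψ) (s, τ)) s)

theorem exp_mul_integral_sub (η : ℝ) :
    Complex.exp (-c * η) * ∫ s in (0 : ℝ)..η, Φ s (η - s) =
      ∫ s in (0 : ℝ)..η,
        Complex.exp (-c * s) * (Complex.exp (-c * ((η - s : ℝ) : ℂ)) * Φ s (η - s)) := by
  rw [← intervalIntegral.integral_const_mul]
  refine intervalIntegral.integral_congr fun s _ => ?_
  rw [← mul_assoc, ← Complex.exp_add]
  congr 2
  push_cast
  ring

theorem integrableOn_exp_mul_convolution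
    (hΦ : Integrable (fun w : ℝ × ℝ =>
        Complex.exp (-c * w.1) * (Complex.exp (-c * w.2) * Φ w.1 w.2))
      ((volume.restrict (Ioi 0)).prod (volume.restrict (Ioi 0)))) :
    IntegrableOn (fun η : ℝ => Complex.exp (-c * η) * ∫ s in (0 : ℝ)..η, Φ s (η - s)) (Ioi 0) := by
  simp_rw [exp_mul_integral_sub]
  exact integrableOn_integral_triangle
    (Ψ := fun s τ => Complex.exp (-c * s) * (Complex.exp (-c * τ) * Φ s τ)) hΦ

theorem integral_exp_mul_convolution
    (hΦ : Integrable (fun w : ℝ × ℝ =>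
        Complex.exp (-c * w.1) * (Complex.exp (-c * w.2) * Φ w.1 w.2))
      ((volume.restrict (Ioi 0)).prod (volume.restrict (Ioi 0)))) :
    ∫ η in Ioi (0 : ℝ), Complex.exp (-c * η) * ∫ s in (0 : ℝ)..η, Φ s (η - s) =
      ∫ s in Ioi (0 : ℝ),
        Complex.exp (-c * s) * ∫ τ in Ioi (0 : ℝ), Complex.exp (-c * τ) * Φ s τ := by
  simp_rw [exp_mul_integral_sub, ← integral_const_mul]
  exact integral_Ioi_integral_triangle
    (Ψ := fun s τ => Complex.exp (-c * s) * (Complex.exp (-c * τ) * Φ s τ)) hΦ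

theorem integrableOn_exp_neg_mul {r : ℝ} (hr : 0 < r) :
    IntegrableOn (fun x : ℝ => Real.exp (-r * x)) (Ioi 0) :=
  integrableOn_exp_mul_Ioi (by linarith) 0

theorem norm_exp_neg_mul (c : ℂ) (x : ℝ) : ‖Complex.exp (-c * x)‖ = Real.exp (-c.re * x) := by
  rw [norm_exp_mul_ofReal, Complex.neg_re]

theorem integrableOn_exp_neg_mul_mul (hc : 0 ≤ c.re) (hp : Integrable p) :
    IntegrableOn (fun s : ℝ => Complex.exp (-c * s) * p s) (Ioi 0) := by
  refine hp.restrict.bdd_mul (c := 1) (by fun_prop)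
    (ae_restrict_of_forall_mem measurableSet_Ioi fun s hs => ?_)
  rw [norm_exp_neg_mul, Real.exp_le_one_iff]
  exact mul_nonpos_of_nonpos_of_nonneg (neg_nonpos.2 hc) (le_of_lt hs)

theorem norm_intervalIntegral_le_integral_norm (hp : Integrable p) (x y : ℝ) :
    ‖∫ t in x..y, p t‖ ≤ ∫ t, ‖p t‖ :=
  intervalIntegral.norm_integral_le_integral_norm_uIoc.trans
    (setIntegral_le_integral hp.norm (ae_of_all _ fun _ => norm_nonneg _))

theorem integrableOn_exp_neg_mul_integral (hc : 0 < c.re) (hp : Integrable p) (x : ℝ) :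
    IntegrableOn (fun s : ℝ => Complex.exp (-c * s) * ∫ y in s..(x + s), p y) (Ioi 0) := by
  have hcont : Continuous fun s : ℝ => ∫ y in s..(x + s), p y := by
    have hprim := intervalIntegral.continuous_primitive (fun _ _ => hp.intervalIntegrable) 0
    refine ((hprim.comp (continuous_const_add x)).sub hprim).congr fun s => ?_
    exact intervalIntegral.integral_interval_sub_left hp.intervalIntegrable hp.intervalIntegrable
  refine Integrable.mono' ((integrableOn_exp_neg_mul hc).mul_const (∫ t, ‖p t‖))
    (by fun_prop) (ae_of_all _ fun s => ?_)
  rw [norm_mul, norm_exp_neg_mul]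
  gcongr
  exact norm_intervalIntegral_le_integral_norm hp _ _

theorem integrable_prod_of_norm_le {μ : Measure ℝ} [SFinite μ] {F : ℝ × ℝ → ℂ} {g h : ℝ → ℝ}
    (hF : AEStronglyMeasurable F (μ.prod (volume.restrict (Ioi 0)))) (hg : Integrable g μ)
    (hh : IntegrableOn h (Ioi 0)) (hle : ∀ s τ, 0 < τ → ‖F (s, τ)‖ ≤ g s * h τ) :
    Integrable F (μ.prod (volume.restrict (Ioi 0))) := by
  have hpos : ∀ᵐ w ∂(μ.prod (volume.restrict (Ioi (0 : ℝ)))), 0 < w.2 :=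
    Measure.quasiMeasurePreserving_snd.ae (ae_restrict_mem measurableSet_Ioi)
  exact (hg.mul_prod hh).mono' hF (hpos.mono fun w hw => hle w.1 w.2 hw)

theorem norm_exp_neg_mul_mul_le {Q B η : ℝ} {z : ℂ} (hz : ‖z‖ ≤ B * Real.exp (Q * η)) :
    ‖Complex.exp (-c * η) * z‖ ≤ B * Real.exp (-(c.re - Q) * η) :=
  calc ‖Complex.exp (-c * η) * z‖ ≤ Real.exp (-c.re * η) * (B * Real.exp (Q * η)) := by
        rw [norm_mul, norm_exp_neg_mul]
        gcongr
    _ = B * Real.exp (-(c.re - Q) * η) := by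
        rw [mul_left_comm, ← Real.exp_add]
        congr 2
        ring

theorem norm_exp_mul_transKernel_le (hq : Integrable q) (c : ℂ) (x : ℝ) {η : ℝ} (hη : 0 ≤ η) :
    ‖Complex.exp (-c * η) * transKernel q x η‖ ≤
      (∫ t, |q t|) / 2 * Real.exp (-(c.re - ∫ t, |q t|) * η) := by
  refine norm_exp_neg_mul_mul_le ?_
  simpa only [Complex.norm_real, Real.norm_eq_abs, abs_of_nonneg hη] using
    abs_transKernel_le hq x η

theorem continuous_exp_mul_transKernel (hq : Integrable q) (c : ℂ) :
    Continuous fun w : ℝ × ℝ => Complex.exp (-c * w.2) * transKernel q w.1 w.2 :=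
  (by fun_prop : Continuous fun w : ℝ × ℝ => Complex.exp (-c * w.2)).mul
    (Complex.continuous_ofReal.comp (continuous_transKernel hq))

/-- The Jost solution for the spectral parameter `-(c / 2) ^ 2`, divided by `exp (-(c / 2) x)`. It
is written as a Laplace transform, which converges for `∫ |q| < c.re`. -/
noncomputable def jost (q : ℝ → ℝ) (c : ℂ) (x : ℝ) : ℂ :=
  1 + 2 * ∫ η in Ioi (0 : ℝ), Complex.exp (-c * η) * transKernel q x η

theorem norm_jost_le (hq : Integrable q) (hc : ∫ t, |q t| < c.re) (x : ℝ) :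
    ‖jost q c x‖ ≤ 1 + (∫ t, |q t|) / (c.re - ∫ t, |q t|) := by
  set Q := ∫ t, |q t|
  have hpos : 0 < c.re - Q := sub_pos.2 hc
  have hint : ‖∫ η in Ioi (0 : ℝ), Complex.exp (-c * η) * transKernel q x η‖ ≤
      Q / 2 * (1 / (c.re - Q)) :=
    calc _ ≤ ∫ η in Ioi (0 : ℝ), Q / 2 * Real.exp (-(c.re - Q) * η) :=
          norm_integral_le_of_norm_le ((integrableOn_exp_neg_mul hpos).const_mul _)
            (ae_restrict_of_forall_mem measurableSet_Ioi fun η hη =>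
              norm_exp_mul_transKernel_le hq c x (le_of_lt hη))
      _ = Q / 2 * (1 / (c.re - Q)) := by
          rw [integral_const_mul, integral_exp_mul_Ioi (by linarith), mul_zero, Real.exp_zero,
            neg_div_neg_eq]
  calc ‖jost q c x‖ ≤ 1 + 2 * (Q / 2 * (1 / (c.re - Q))) := by
        refine (norm_add_le _ _).trans ?_
        rw [norm_one, norm_mul, Complex.norm_ofNat]
        gcongr
    _ = 1 + Q / (c.re - Q) := by ring

theorem continuous_jost (hq : Integrable q) (hc : ∫ t, |q t| < c.re) : Continuous (jost q c) := by
  have hcont := continuous_exp_mul_transKernel hq c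
  exact continuous_const.add (continuous_const.mul (continuous_of_dominated
    (bound := fun η => (∫ t, |q t|) / 2 * Real.exp (-(c.re - ∫ t, |q t|) * η))
    (fun x => (hcont.comp (Continuous.prodMk_right x)).aestronglyMeasurable)
    (fun x => ae_restrict_of_forall_mem measurableSet_Ioi fun η hη =>
      norm_exp_mul_transKernel_le hq c x (le_of_lt hη))
    ((integrableOn_exp_neg_mul (sub_pos.2 hc)).const_mul _)
    (ae_of_all _ fun η => hcont.comp (Continuous.prodMk_left η))))

theorem integrable_mul_jost (hq : Integrable q) (hc : ∫ t, |q t| < c.re) :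
    Integrable fun t => (q t : ℂ) * jost q c t :=
  hq.ofReal.mul_bdd (continuous_jost hq hc).aestronglyMeasurable (ae_of_all _ (norm_jost_le hq hc))

theorem integrable_mul_exp_mul_transKernel (hq : Integrable q) (hc : ∫ t, |q t| < c.re)
    {μ : Measure ℝ} [SFinite μ] (hp : Integrable p μ) :
    Integrable (fun w : ℝ × ℝ => p w.1 * (Complex.exp (-c * w.2) * transKernel q w.1 w.2))
      (μ.prod (volume.restrict (Ioi 0))) := by
  refine integrable_prod_of_norm_le (hp.aestronglyMeasurable.comp_fst.mul
    (continuous_exp_mul_transKernel hq c).aestronglyMeasurable) hp.norm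
    ((integrableOn_exp_neg_mul (sub_pos.2 hc)).const_mul ((∫ t, |q t|) / 2)) fun s τ hτ => ?_
  rw [norm_mul]
  gcongr
  exact norm_exp_mul_transKernel_le hq c s hτ.le

theorem integral_exp_mul_integral_mul_transKernel (hq : Integrable q) (hc : ∫ t, |q t| < c.re)
    (x y : ℝ) :
    2 * ∫ τ in Ioi (0 : ℝ),
        Complex.exp (-c * τ) * ((∫ t in x..y, q t * transKernel q t τ : ℝ) : ℂ) =
      (∫ t in x..y, (q t : ℂ) * jost q c t) - ∫ t in x..y, (q t : ℂ) := by
  have hqc : Integrable fun t => (q t : ℂ) := hq.ofReal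
  have hswap := intervalIntegral_integral_swap (a := x) (b := y) (f := fun t τ : ℝ => (q t : ℂ) *
    (Complex.exp (-c * τ) * transKernel q t τ))
    (integrable_mul_exp_mul_transKernel hq hc hqc.restrict)
  have hjost : ∀ t, (q t : ℂ) * jost q c t - q t =
      2 * ∫ τ in Ioi (0 : ℝ), (q t : ℂ) * (Complex.exp (-c * τ) * transKernel q t τ) := by
    intro t
    rw [integral_const_mul, jost]
    ring
  rw [← intervalIntegral.integral_sub (integrable_mul_jost hq hc).intervalIntegrable
    hqc.intervalIntegrable]
  simp_rw [hjost]
  rw [intervalIntegral.integral_const_mul, hswap]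
  congr 2 with τ
  rw [← intervalIntegral.integral_ofReal, ← intervalIntegral.integral_const_mul]
  congr 1 with t
  push_cast
  ring

theorem integrable_exp_mul_exp_mul_integral_mul_transKernel (hq : Integrable q)
    (hc : ∫ t, |q t| < c.re) (x : ℝ) :
    Integrable (fun w : ℝ × ℝ => Complex.exp (-c * w.1) * (Complex.exp (-c * w.2) *
        ((∫ y in w.1..(x + w.1), q y * transKernel q y w.2 : ℝ) : ℂ)))
      ((volume.restrict (Ioi 0)).prod (volume.restrict (Ioi 0))) := by
  set Q := ∫ t, |q t|
  have hQ : 0 ≤ Q := integral_nonneg fun _ => abs_nonneg _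
  have hcont : Continuous fun w : ℝ × ℝ => ∫ y in w.1..(x + w.1), q y * transKernel q y w.2 :=
    continuous_integral_mul hq (Φ := fun (w : ℝ × ℝ) y => transKernel q y w.2)
      ((continuous_transKernel hq).comp
        (by fun_prop : Continuous fun w : (ℝ × ℝ) × ℝ => (w.2, w.1.2)))
      (by fun_prop) (by fun_prop)
  refine integrable_prod_of_norm_le (by fun_prop)
    (integrableOn_exp_neg_mul (hQ.trans_lt hc))
    ((integrableOn_exp_neg_mul (sub_pos.2 hc)).const_mul (Q * (Q / 2))) fun s τ hτ => ?_
  rw [norm_mul, norm_exp_neg_mul]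
  refine mul_le_mul_of_nonneg_left (norm_exp_neg_mul_mul_le ?_) (Real.exp_pos _).le
  rw [Complex.norm_real, Real.norm_eq_abs, mul_assoc]
  exact abs_integral_mul_le hq (by positivity) fun y _ => by
    simpa only [abs_of_nonneg hτ.le] using abs_transKernel_le hq y τ

theorem jost_eq (hq : Integrable q) (hc : ∫ t, |q t| < c.re) (x : ℝ) :
    jost q c x = 1 - ∫ s in Ioi (0 : ℝ), Complex.exp (-c * s) *
      ∫ y in s..(x + s), (q y : ℂ) * jost q c y := by
  have hc0 : 0 < c.re := (integral_nonneg fun _ => abs_nonneg _).trans_lt hc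
  have hint := integrable_exp_mul_exp_mul_integral_mul_transKernel hq hc x
  have hqc : Integrable fun t => (q t : ℂ) := hq.ofReal
  have hq₁ := integrableOn_exp_neg_mul_integral hc0 hqc x
  have hq₂ := integrableOn_exp_neg_mul_integral hc0 (integrable_mul_jost hq hc) x
  have hV : ∀ η : ℝ, Complex.exp (-c * η) * (transKernel q x η : ℂ) =
      -(1 / 2) * (Complex.exp (-c * η) * ∫ y in η..(x + η), (q y : ℂ)) -
        Complex.exp (-c * η) * ∫ s in (0 : ℝ)..η,
          ((∫ y in s..(x + s), q y * transKernel q y (η - s) : ℝ) : ℂ) := by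
    intro η
    rw [transKernel_eq hq x η, intervalIntegral.integral_ofReal, intervalIntegral.integral_ofReal]
    push_cast
    ring
  have hJ : ∀ s : ℝ, (∫ τ in Ioi (0 : ℝ), Complex.exp (-c * τ) *
      ((∫ y in s..(x + s), q y * transKernel q y τ : ℝ) : ℂ)) =
      ((∫ y in s..(x + s), (q y : ℂ) * jost q c y) - ∫ y in s..(x + s), (q y : ℂ)) / 2 := by
    intro s
    rw [← integral_exp_mul_integral_mul_transKernel hq hc, mul_div_cancel_left₀ _ two_ne_zero]
  rw [jost]
  simp_rw [hV]
  rw [integral_sub (hq₁.const_mul _) (integrableOn_exp_mul_convolution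
      (Φ := fun s τ => ((∫ y in s..(x + s), q y * transKernel q y τ : ℝ) : ℂ)) hint),
    integral_exp_mul_convolution
      (Φ := fun s τ => ((∫ y in s..(x + s), q y * transKernel q y τ : ℝ) : ℂ)) hint,
    integral_const_mul]
  simp_rw [hJ, mul_div_assoc', mul_sub]
  rw [integral_div, integral_sub hq₂ hq₁]
  ring

theorem integrable_exp_mul_exp_mul_mul_transKernel (hq : Integrable q) (hc : ∫ t, |q t| < c.re) :
    Integrable (fun w : ℝ × ℝ => Complex.exp (-c * w.1) * (Complex.exp (-c * w.2) *
        ((q w.1 * transKernel q w.1 w.2 : ℝ) : ℂ)))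
      ((volume.restrict (Ioi 0)).prod (volume.restrict (Ioi 0))) := by
  have hc0 : 0 ≤ c.re := (integral_nonneg fun _ => abs_nonneg _).trans hc.le
  have hqc : Integrable fun t => (q t : ℂ) := hq.ofReal
  refine (integrable_mul_exp_mul_transKernel hq hc
    (integrableOn_exp_neg_mul_mul hc0 hqc)).congr (ae_of_all _ fun w => ?_)
  push_cast
  ring

theorem exp_mul_amplitude (q : ℝ → ℝ) (c : ℂ) (α : ℝ) :
    Complex.exp (-c * α) * amplitude q α = Complex.exp (-c * α) * q α +
      2 * (Complex.exp (-c * α) *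
        ∫ s in (0 : ℝ)..α, ((q s * transKernel q s (α - s) : ℝ) : ℂ)) := by
  rw [amplitude, intervalIntegral.integral_ofReal]
  push_cast
  ring

theorem integrableOn_exp_mul_amplitude (hq : Integrable q) (hc : ∫ t, |q t| < c.re) :
    IntegrableOn (fun α : ℝ => Complex.exp (-c * α) * amplitude q α) (Ioi 0) := by
  have hc0 : 0 ≤ c.re := (integral_nonneg fun _ => abs_nonneg _).trans hc.le
  have hqc : Integrable fun t => (q t : ℂ) := hq.ofReal
  simp_rw [exp_mul_amplitude]
  exact (integrableOn_exp_neg_mul_mul hc0 hqc).add ((integrableOn_exp_mul_convolution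
    (Φ := fun s τ => ((q s * transKernel q s τ : ℝ) : ℂ))
    (integrable_exp_mul_exp_mul_mul_transKernel hq hc)).const_mul 2)

theorem integral_exp_mul_amplitude (hq : Integrable q) (hc : ∫ t, |q t| < c.re) :
    ∫ α in Ioi (0 : ℝ), Complex.exp (-c * α) * amplitude q α =
      ∫ s in Ioi (0 : ℝ), Complex.exp (-c * s) * (q s * jost q c s) := by
  have hc0 : 0 ≤ c.re := (integral_nonneg fun _ => abs_nonneg _).trans hc.le
  have hqc : Integrable fun t => (q t : ℂ) := hq.ofReal
  have hint := integrable_exp_mul_exp_mul_mul_transKernel hq hc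
  have hq₁ := integrableOn_exp_neg_mul_mul hc0 hqc
  have hjost : ∀ s : ℝ, 2 * (Complex.exp (-c * s) * ∫ τ in Ioi (0 : ℝ), Complex.exp (-c * τ) *
      ((q s * transKernel q s τ : ℝ) : ℂ)) =
      Complex.exp (-c * s) * (q s * jost q c s) - Complex.exp (-c * s) * q s := by
    intro s
    rw [jost]
    simp_rw [Complex.ofReal_mul, mul_left_comm (Complex.exp _) (q s : ℂ)]
    rw [integral_const_mul]
    ring
  simp_rw [exp_mul_amplitude]
  rw [integral_add hq₁ ((integrableOn_exp_mul_convolution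
      (Φ := fun s τ => ((q s * transKernel q s τ : ℝ) : ℂ)) hint).const_mul 2),
    integral_const_mul, integral_exp_mul_convolution
      (Φ := fun s τ => ((q s * transKernel q s τ : ℝ) : ℂ)) hint, ← integral_const_mul]
  simp_rw [hjost]
  rw [integral_sub (integrableOn_exp_neg_mul_mul hc0 (integrable_mul_jost hq hc)) hq₁]
  ring

end Laplace

section Jost

variable {q : ℝ → ℝ} {p : ℝ → ℂ} {c κ : ℂ}

/-- The Laplace transform of the translates of `p`: the solution of `y' = c * y - p` that is bounded
at infinity. -/
noncomputable def laplaceShift (p : ℝ → ℂ) (c : ℂ) (x : ℝ) : ℂ :=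
  ∫ s in Ioi (0 : ℝ), Complex.exp (-c * s) * p (x + s)

theorem exp_mul_exp_neg (c : ℂ) (x : ℝ) : Complex.exp (c * x) * Complex.exp (-c * x) = 1 := by
  rw [← Complex.exp_add, neg_mul, add_neg_cancel, Complex.exp_zero]

theorem laplaceShift_eq (hp : Integrable p) (hc : 0 ≤ c.re) {x : ℝ} (hx : 0 ≤ x) :
    laplaceShift p c x = Complex.exp (c * x) *
      (laplaceShift p c 0 - ∫ t in (0 : ℝ)..x, Complex.exp (-c * t) * p t) := by
  have hint := integrableOn_exp_neg_mul_mul hc hp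
  have hshift : ∫ s in Ioi (0 : ℝ), Complex.exp (-c * ((x + s : ℝ) : ℂ)) * p (x + s) =
      ∫ t in Ioi x, Complex.exp (-c * t) * p t := by
    have h := (measurePreserving_add_left volume x).setIntegral_preimage_emb
      (measurableEmbedding_addLeft x) (fun t => Complex.exp (-c * t) * p t) (Ioi x)
    rwa [preimage_const_add_Ioi, sub_self] at h
  have hsplit := intervalIntegral.integral_interval_add_Ioi hint
    (hint.mono_set (Ioi_subset_Ioi hx))
  have hzero : laplaceShift p c 0 = ∫ t in Ioi (0 : ℝ), Complex.exp (-c * t) * p t := by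
    simp only [laplaceShift, zero_add]
  rw [hzero, ← hsplit, add_sub_cancel_left, ← hshift, ← integral_const_mul]
  refine setIntegral_congr_fun measurableSet_Ioi fun s _ => ?_
  rw [← mul_assoc, ← Complex.exp_add]
  congr 2
  push_cast
  ring

theorem isPrimitiveOn_laplaceShift (hp : Integrable p) (hc : 0 ≤ c.re) {X : ℝ} (hX : 0 ≤ X) :
    IsPrimitiveOn (laplaceShift p c) (fun x => c * laplaceShift p c x - p x) 0 X := by
  have hexp : IsPrimitiveOn (fun x : ℝ => laplaceShift p c 0 -
      ∫ t in (0 : ℝ)..x, Complex.exp (-c * t) * p t) (fun t => -(Complex.exp (-c * t) * p t)) 0 X :=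
    .of_eq_add (hp.intervalIntegrable.continuousOn_mul (by fun_prop)).neg fun x _ => by
      rw [intervalIntegral.integral_same, intervalIntegral.integral_neg, sub_zero, sub_eq_add_neg]
  have hval : ∀ x ∈ uIcc 0 X, laplaceShift p c x = Complex.exp (c * x) *
      (laplaceShift p c 0 - ∫ t in (0 : ℝ)..x, Complex.exp (-c * t) * p t) := fun x hx =>
    laplaceShift_eq hp hc (uIcc_of_le hX ▸ hx).1
  refine ((hexp.exp_mul c).congr_left hval).congr_right fun x hx => ?_
  rw [hval x hx]
  linear_combination (-p x) * exp_mul_exp_neg c x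

theorem integrable_exp_neg_mul_mul_add (hp : Integrable p) (hc : 0 ≤ c.re) (a b : ℝ) :
    Integrable (fun w : ℝ × ℝ => Complex.exp (-c * w.2) * p (w.1 + w.2))
      ((volume.restrict (uIoc a b)).prod (volume.restrict (Ioi 0))) := by
  have hadd : Integrable (fun w : ℝ × ℝ => p (w.1 + w.2))
      ((volume.restrict (uIoc a b)).prod volume) := by
    have : IsFiniteMeasure (volume.restrict (uIoc a b)) :=
      isFiniteMeasure_restrict.2 measure_Ioc_lt_top.ne
    exact (measurePreserving_prod_add (volume.restrict (uIoc a b))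
      volume).integrable_comp_of_integrable (hp.comp_snd _)
  have hpos : ∀ᵐ w ∂((volume.restrict (uIoc a b)).prod (volume.restrict (Ioi (0 : ℝ)))), 0 < w.2 :=
    Measure.quasiMeasurePreserving_snd.ae (ae_restrict_mem measurableSet_Ioi)
  refine (hadd.mono_measure (Measure.prod_mono le_rfl Measure.restrict_le_self)).bdd_mul (c := 1)
    (by fun_prop) (hpos.mono fun w hw => ?_)
  rw [norm_exp_neg_mul, Real.exp_le_one_iff]
  exact mul_nonpos_of_nonpos_of_nonneg (neg_nonpos.2 hc) hw.le

theorem isPrimitiveOn_integral_exp_neg_mul_integral (hp : Integrable p) (hc : 0 ≤ c.re) {X : ℝ}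
    (hX : 0 ≤ X) :
    IsPrimitiveOn (fun x : ℝ => ∫ s in Ioi (0 : ℝ), Complex.exp (-c * s) * ∫ y in s..(x + s), p y)
      (laplaceShift p c) 0 X := by
  refine .of_eq_add (isPrimitiveOn_laplaceShift hp hc hX).continuousOn.intervalIntegrable
    fun x _ => ?_
  simp only [laplaceShift]
  rw [intervalIntegral_integral_swap (integrable_exp_neg_mul_mul_add hp hc 0 x)]
  simp only [intervalIntegral.integral_const_mul, intervalIntegral.integral_comp_add_right,
    zero_add, intervalIntegral.integral_same, mul_zero, integral_zero]

theorem laplaceShift_eq_zero {a : ℝ} (hp : ∀ y, a < y → p y = 0) : laplaceShift p c a = 0 :=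
  setIntegral_eq_zero_of_forall_eq_zero fun s hs => by
    rw [hp _ (lt_add_of_pos_right a hs), mul_zero]

/-- The derivative of `jost q c`. -/
noncomputable def jostDeriv (q : ℝ → ℝ) (c : ℂ) (x : ℝ) : ℂ :=
  -laplaceShift (fun t => (q t : ℂ) * jost q c t) c x

theorem jost_zero (hq : Integrable q) (hc : ∫ t, |q t| < c.re) : jost q c 0 = 1 := by
  simp only [jost_eq hq hc 0, zero_add, intervalIntegral.integral_same, mul_zero, integral_zero,
    sub_zero]

theorem jostDeriv_zero (hq : Integrable q) (hc : ∫ t, |q t| < c.re) :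
    jostDeriv q c 0 = -∫ α in Ioi (0 : ℝ), Complex.exp (-c * α) * amplitude q α := by
  simp only [jostDeriv, laplaceShift, zero_add, integral_exp_mul_amplitude hq hc]

theorem isPrimitiveOn_jost (hq : Integrable q) (hc : ∫ t, |q t| < c.re) {X : ℝ} (hX : 0 ≤ X) :
    IsPrimitiveOn (jost q c) (jostDeriv q c) 0 X := by
  have hc0 : 0 ≤ c.re := (integral_nonneg fun _ => abs_nonneg _).trans hc.le
  have hone : IsPrimitiveOn (fun _ => (1 : ℂ)) (fun _ => 0) 0 X :=
    .of_hasDerivAt (fun x => hasDerivAt_const x 1) continuous_const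
  exact ((hone.sub (isPrimitiveOn_integral_exp_neg_mul_integral (integrable_mul_jost hq hc) hc0
    hX)).congr_left fun x _ => jost_eq hq hc x).congr_right fun x _ => zero_sub _

theorem isPrimitiveOn_jostDeriv (hq : Integrable q) (hc : ∫ t, |q t| < c.re) {X : ℝ}
    (hX : 0 ≤ X) :
    IsPrimitiveOn (jostDeriv q c) (fun x => q x * jost q c x + c * jostDeriv q c x) 0 X := by
  have hc0 : 0 ≤ c.re := (integral_nonneg fun _ => abs_nonneg _).trans hc.le
  refine (((isPrimitiveOn_laplaceShift (integrable_mul_jost hq hc) hc0 hX).const_mul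
    (-1)).congr_left fun x _ => (neg_one_mul _).symm).congr_right fun x _ => ?_
  rw [jostDeriv]
  ring

theorem isSolution_jost (hq : Integrable q) (hκ : ∫ t, |q t| < (2 * κ).re) :
    IsSolution q ⊤ (-κ ^ 2) (fun x => Complex.exp (-κ * x) * jost q (2 * κ) x)
      fun x => Complex.exp (-κ * x) * (jostDeriv q (2 * κ) x - κ * jost q (2 * κ) x) := by
  have hfst {X : ℝ} (hX : 0 ≤ X) :
      IsPrimitiveOn (fun x => Complex.exp (-κ * x) * jost q (2 * κ) x)
        (fun x => Complex.exp (-κ * x) * (jostDeriv q (2 * κ) x - κ * jost q (2 * κ) x)) 0 X :=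
    ((isPrimitiveOn_jost hq hκ hX).exp_mul (-κ)).congr_right fun x _ => by ring
  have hsnd {X : ℝ} (hX : 0 ≤ X) :
      IsPrimitiveOn
        (fun x => Complex.exp (-κ * x) * (jostDeriv q (2 * κ) x - κ * jost q (2 * κ) x))
        (fun x => ((q x : ℂ) - -κ ^ 2) * (Complex.exp (-κ * x) * jost q (2 * κ) x)) 0 X :=
    (((isPrimitiveOn_jostDeriv hq hκ hX).sub
      ((isPrimitiveOn_jost hq hκ hX).const_mul κ)).exp_mul (-κ)).congr_right fun x _ => by ring
  have hcont {F f : ℝ → ℂ} (hF : ∀ {X : ℝ}, 0 ≤ X → IsPrimitiveOn F f 0 X) :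
      ContinuousOn F {x : ℝ | 0 ≤ x ∧ (x : EReal) < ⊤} :=
    continuousOn_of_locally_continuousOn fun x hx => by
      have hx1 : 0 ≤ x + 1 := add_nonneg hx.1 zero_le_one
      exact ⟨Iio (x + 1), isOpen_Iio, lt_add_one x, (hF hx1).continuousOn.mono fun y hy =>
        uIcc_of_le hx1 ▸ ⟨hy.1.1, le_of_lt hy.2⟩⟩
  exact ⟨hcont hfst, hcont hsnd, fun x hx _ => (hfst hx).eq_add right_mem_uIcc,
    fun x hx _ => (hsnd hx).eq_add right_mem_uIcc⟩

end Jost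

section Truncation

variable {q : ℝ → ℝ} {a x α : ℝ}

/-- The restriction of a potential to `[0, a]`, extended by `0`. -/
noncomputable def truncation (q : ℝ → ℝ) (a : ℝ) : ℝ → ℝ := (Icc 0 a).indicator q

theorem integrable_truncation (ha : 0 ≤ a) (hq : IntervalIntegrable q volume 0 a) :
    Integrable (truncation q a) := by
  rw [truncation, integrable_indicator_iff measurableSet_Icc, integrableOn_Icc_iff_integrableOn_Ioc]
  exact (intervalIntegrable_iff_integrableOn_Ioc_of_le ha).1 hq

theorem truncation_of_mem (hx : x ∈ Icc 0 a) : truncation q a x = q x :=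
  indicator_of_mem hx q

theorem truncation_of_lt (hx : a < x) : truncation q a x = 0 :=
  indicator_of_notMem (fun h => hx.not_ge h.2) q

theorem integral_abs_truncation (ha : 0 ≤ a) :
    ∫ t, |truncation q a t| = ∫ t in (0 : ℝ)..a, |q t| := by
  have habs : ∀ t, |truncation q a t| = (Icc 0 a).indicator (fun t => |q t|) t := fun t =>
    (congrFun (indicator_comp_of_zero (s := Icc 0 a) (f := q) (g := abs) abs_zero) t).symm
  simp_rw [habs]
  rw [integral_indicator measurableSet_Icc, integral_Icc_eq_integral_Ioc,
    intervalIntegral.integral_of_le ha]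

theorem amplitude_truncation (hα : α ∈ Icc 0 a) :
    amplitude (truncation q α) α = amplitude (truncation q a) α :=
  amplitude_congr (a := α) (fun y hy => by
    rw [truncation_of_mem hy, truncation_of_mem ⟨hy.1, hy.2.trans hα.2⟩]) ⟨hα.1, le_rfl⟩

end Truncation

section Comparison

variable {q q₁ q₂ : ℝ → ℝ} {b b₁ b₂ : EReal} {z κ : ℂ} {u v u₁ v₁ u₂ v₂ : ℝ → ℂ} {a M : ℝ}

theorem IsSolution.wronskian_eq_of_eqOn (hq₁ : IsIntegrableUpTo q₁ b₁)
    (hq₂ : IsIntegrableUpTo q₂ b₂) (h₁ : IsSolution q₁ b₁ z u₁ v₁) (h₂ : IsSolution q₂ b₂ z u₂ v₂)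
    (ha : 0 ≤ a) (hab₁ : (a : EReal) < b₁) (hab₂ : (a : EReal) < b₂)
    (hq : EqOn q₁ q₂ (Icc 0 a)) :
    u₁ a * v₂ a - v₁ a * u₂ a = u₁ 0 * v₂ 0 - v₁ 0 * u₂ 0 := by
  have hW : IsPrimitiveOn (fun x => u₁ x * v₂ x - v₁ x * u₂ x) (fun _ => 0) 0 a :=
    (((h₁.primitive_fst ha hab₁).mul (h₂.primitive_snd hq₂ ha hab₂)).sub
      ((h₁.primitive_snd hq₁ ha hab₁).mul (h₂.primitive_fst ha hab₂))).congr_right fun x hx => by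
        rw [hq (uIcc_of_le ha ▸ hx)]
        ring
  simpa only [intervalIntegral.integral_zero, add_zero] using hW.eq_add right_mem_uIcc

theorem jostDeriv_eq_zero (hq : ∀ y, a < y → q y = 0) (c : ℂ) : jostDeriv q c a = 0 := by
  rw [jostDeriv, laplaceShift_eq_zero fun y hy => by rw [hq y hy, Complex.ofReal_zero, zero_mul],
    neg_zero]

-- The Jost solution `ψ` of the truncated potential satisfies `ψ' = -κ ψ` at `a`.
theorem IsSolution.div_sub_eq (h : IsSolution q b (-κ ^ 2) u v) (hq : IsIntegrableUpTo q b)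
    (ha : 0 ≤ a) (hab : (a : EReal) < b) (hu : u 0 ≠ 0)
    (hκ : ∫ t, |truncation q a t| < (2 * κ).re) :
    v 0 / u 0 - (jostDeriv (truncation q a) (2 * κ) 0 - κ) =
      Complex.exp (-κ * a) * jost (truncation q a) (2 * κ) a * (v a + κ * u a) / u 0 := by
  have hqi := integrable_truncation ha (hq.intervalIntegrable ha hab)
  have hW := h.wronskian_eq_of_eqOn hq (fun _ => hqi.integrableOn) (isSolution_jost hqi hκ) ha hab
    (EReal.coe_lt_top a) fun x hx => (truncation_of_mem hx).symm
  simp only [jost_zero hqi hκ, jostDeriv_eq_zero fun _ => truncation_of_lt, Complex.ofReal_zero,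
    mul_zero, Complex.exp_zero] at hW
  rw [eq_div_iff hu, sub_mul, div_mul_cancel₀ _ hu]
  linear_combination hW

theorem norm_jost_le_two (hq : Integrable q) {c : ℂ} (hc : 2 * ((∫ t, |q t|) + 1) ≤ c.re) (x : ℝ) :
    ‖jost q c x‖ ≤ 2 := by
  have hQ : 0 ≤ ∫ t, |q t| := integral_nonneg fun _ => abs_nonneg _
  have hdiv : (∫ t, |q t|) / (c.re - ∫ t, |q t|) ≤ 1 := by
    rw [div_le_one (by linarith)]
    linarith
  linarith [norm_jost_le hq (by linarith) x]

theorem IsSolution.norm_div_sub_le (h : IsSolution q b (-κ ^ 2) u v) (hq : IsIntegrableUpTo q b)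
    (ha : 0 ≤ a) (hab : (a : EReal) < b) (hu : u 0 ≠ 0) (hM0 : 0 ≤ M)
    (hM : ∀ x ∈ Icc 0 a, ‖v x + κ * u x‖ ≤ M * ‖u x‖)
    (hκ : (∫ t in (0 : ℝ)..a, |q t|) + 1 ≤ κ.re) :
    ‖v 0 / u 0 - (jostDeriv (truncation q a) (2 * κ) 0 - κ)‖ ≤
      2 * M * Real.exp (M * a) * Real.exp (-(2 * κ).re * a) := by
  have hqi := integrable_truncation ha (hq.intervalIntegrable ha hab)
  have hre : (2 * κ).re = 2 * κ.re := by simp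
  have hQ := integral_abs_truncation (q := q) ha
  have hQ0 : 0 ≤ ∫ t, |truncation q a t| := integral_nonneg fun _ => abs_nonneg _
  have hjost : ‖jost (truncation q a) (2 * κ) a‖ ≤ 2 :=
    norm_jost_le_two hqi (by rw [hQ, hre]; linarith) a
  have hva : ‖v a + κ * u a‖ ≤ M * (‖u 0‖ * Real.exp ((M - κ.re) * a)) :=
    (hM a ⟨ha, le_rfl⟩).trans (by gcongr; exact h.norm_le_mul_exp ha hab hM)
  rw [h.div_sub_eq hq ha hab hu (by rw [hre]; linarith), norm_div, norm_mul, norm_mul,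
    norm_exp_neg_mul, div_le_iff₀ (norm_pos_iff.2 hu)]
  calc Real.exp (-κ.re * a) * ‖jost (truncation q a) (2 * κ) a‖ * ‖v a + κ * u a‖
      ≤ Real.exp (-κ.re * a) * 2 * (M * (‖u 0‖ * Real.exp ((M - κ.re) * a))) := by gcongr
    _ = 2 * M * (Real.exp (-κ.re * a) * Real.exp ((M - κ.re) * a)) * ‖u 0‖ := by ring
    _ = 2 * M * (Real.exp (M * a) * Real.exp (-(2 * κ).re * a)) * ‖u 0‖ := by
        rw [← Real.exp_add, ← Real.exp_add]
        congr 3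
        rw [hre]
        ring
    _ = 2 * M * Real.exp (M * a) * Real.exp (-(2 * κ).re * a) * ‖u 0‖ := by ring

theorem norm_integral_Ioi_exp_mul_amplitude_le (hq : Integrable q) (ha : 0 ≤ a)
    (hqa : ∀ y, a < y → q y = 0) {c : ℂ} (hc : (∫ t, |q t|) + 1 ≤ c.re) :
    ‖∫ α in Ioi a, Complex.exp (-c * α) * (amplitude q α : ℂ)‖ ≤
      (∫ t, |q t|) ^ 2 * Real.exp ((∫ t, |q t|) * a) * Real.exp (-c.re * a) := by
  set Q := ∫ t, |q t|
  have hr : -(c.re - Q) < 0 := by linarith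
  have hle : ∀ α ∈ Ioi a, ‖Complex.exp (-c * α) * (amplitude q α : ℂ)‖ ≤
      Q ^ 2 * Real.exp (-(c.re - Q) * α) := fun α hα => by
    have hamp := abs_amplitude_sub_le hq (ha.trans (le_of_lt hα))
    rw [hqa α hα, sub_zero, mul_comm α] at hamp
    exact norm_exp_neg_mul_mul_le (by rwa [Complex.norm_real, Real.norm_eq_abs])
  calc _ ≤ ∫ α in Ioi a, Q ^ 2 * Real.exp (-(c.re - Q) * α) :=
        norm_integral_le_of_norm_le ((integrableOn_exp_mul_Ioi hr a).const_mul _)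
          (ae_restrict_of_forall_mem measurableSet_Ioi hle)
    _ = Q ^ 2 * (Real.exp (-(c.re - Q) * a) / (c.re - Q)) := by
        rw [integral_const_mul, integral_exp_mul_Ioi hr, neg_div_neg_eq]
    _ ≤ Q ^ 2 * Real.exp (-(c.re - Q) * a) := by
        gcongr
        exact div_le_self (Real.exp_pos _).le (by linarith)
    _ = Q ^ 2 * Real.exp (Q * a) * Real.exp (-c.re * a) := by
        rw [mul_assoc, ← Real.exp_add]
        congr 2
        ring

theorem jostDeriv_sub_eq (hq : Integrable q) (hκ : ∫ t, |q t| < (2 * κ).re) (ha : 0 ≤ a) :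
    jostDeriv q (2 * κ) 0 - κ =
      (-κ - ∫ α in (0 : ℝ)..a, (amplitude q α : ℂ) * Complex.exp (-2 * (α : ℂ) * κ)) -
        ∫ α in Ioi a, Complex.exp (-(2 * κ) * α) * (amplitude q α : ℂ) := by
  have hint := integrableOn_exp_mul_amplitude hq hκ
  have hexp : ∀ α : ℝ, (amplitude q α : ℂ) * Complex.exp (-2 * (α : ℂ) * κ) =
      Complex.exp (-(2 * κ) * α) * amplitude q α := fun α => by
    rw [mul_comm, show -2 * (α : ℂ) * κ = -(2 * κ) * α by ring]
  simp_rw [hexp]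
  rw [jostDeriv_zero hq hκ, ← intervalIntegral.integral_interval_add_Ioi hint
    (hint.mono_set (Ioi_subset_Ioi ha))]
  ring

theorem IsSolution.norm_div_sub_amplitude_le (h : IsSolution q b (-κ ^ 2) u v)
    (hq : IsIntegrableUpTo q b) (hu : IsNonzero b u) (ha : 0 ≤ a) (hab : (a : EReal) < b)
    (hM0 : 0 ≤ M) (hM : ∀ x ∈ Icc 0 a, ‖v x + κ * u x‖ ≤ M * ‖u x‖)
    (hκ : (∫ t in (0 : ℝ)..a, |q t|) + 1 ≤ κ.re) :
    ‖v 0 / u 0 - (-κ - ∫ α in (0 : ℝ)..a,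
        (amplitude (truncation q a) α : ℂ) * Complex.exp (-2 * (α : ℂ) * κ))‖ ≤
      (2 * M * Real.exp (M * a) + (∫ t in (0 : ℝ)..a, |q t|) ^ 2 *
        Real.exp ((∫ t in (0 : ℝ)..a, |q t|) * a)) * ‖Complex.exp (-2 * (a : ℂ) * κ)‖ := by
  have hqi := integrable_truncation ha (hq.intervalIntegrable ha hab)
  have hre : (2 * κ).re = 2 * κ.re := by simp
  have hQ := integral_abs_truncation (q := q) ha
  have hQ0 : 0 ≤ ∫ t, |truncation q a t| := integral_nonneg fun _ => abs_nonneg _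
  have hu0 : u 0 ≠ 0 := fun h0 => (h.initial_ne_zero hq hu).elim (· h0) fun hv0 => hv0 <| by
    simpa only [h0, mul_zero, add_zero, norm_zero, norm_le_zero_iff] using hM 0 ⟨le_rfl, ha⟩
  have htail := norm_integral_Ioi_exp_mul_amplitude_le hqi ha (fun _ => truncation_of_lt)
    (c := 2 * κ) (by rw [hre]; linarith)
  have hexp : ‖Complex.exp (-2 * (a : ℂ) * κ)‖ = Real.exp (-(2 * κ).re * a) := by
    rw [show -2 * (a : ℂ) * κ = -(2 * κ) * a by ring, norm_exp_neg_mul]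
  rw [hQ] at htail
  rw [hexp, add_mul, ← sub_sub_sub_cancel_right _ _ (∫ α in Ioi a,
    Complex.exp (-(2 * κ) * α) * (amplitude (truncation q a) α : ℂ)),
    ← jostDeriv_sub_eq hqi (by rw [hre]; linarith) ha, sub_right_comm]
  exact (norm_sub_le _ _).trans (add_le_add (h.norm_div_sub_le hq ha hab hu0 hM0 hM hκ) htail)

end Comparison

section Sector

variable {a ε : ℝ}

theorem exists_forall_norm_le_of_mem_sector (hε : 0 < ε) : ∃ L : ℝ, 0 < L ∧ ∀ κ : ℂ,
    -(Real.pi / 2) + ε < κ.arg → κ.arg < -ε → ‖κ‖ ≤ L * -κ.im ∧ ‖κ‖ ≤ L * κ.re := by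
  by_cases hlt : ε < Real.pi / 2
  · have hsin : 0 < Real.sin ε := Real.sin_pos_of_pos_of_lt_pi hε (by linarith)
    refine ⟨1 / Real.sin ε, by positivity, fun κ hl hr => ?_⟩
    have hle {φ : ℝ} (hε' : ε ≤ φ) (hφ : φ ≤ Real.pi / 2) :
        ‖κ‖ ≤ 1 / Real.sin ε * (‖κ‖ * Real.sin φ) := by
      rw [div_mul_eq_mul_div, le_div_iff₀ hsin, one_mul]
      gcongr
      exact Real.sin_le_sin_of_le_of_le_pi_div_two (by linarith) hφ hε'
    constructor
    · rw [← Complex.norm_mul_sin_arg, ← mul_neg, ← Real.sin_neg]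
      exact hle (by linarith) (by linarith)
    · rw [← Complex.norm_mul_cos_arg, ← Real.cos_neg, ← Real.sin_pi_div_two_sub]
      exact hle (by linarith) (by linarith)
  · exact ⟨1, one_pos, fun κ hl hr => absurd (hl.trans hr) (by linarith)⟩

theorem eventually_sectorAtInfinity {R : ℝ} {P : ℂ → Prop}
    (h : ∀ κ : ℂ, -(Real.pi / 2) + ε < κ.arg → κ.arg < -ε → R ≤ ‖κ‖ → P κ) :
    ∀ᶠ κ in sectorAtInfinity ε, P κ := by
  rw [sectorAtInfinity, eventually_inf_principal]
  filter_upwards [(eventually_ge_atTop R).comap (fun κ : ℂ => ‖κ‖)] with κ hκ hsec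
  exact h κ hsec.1 hsec.2 hκ

theorem tendsto_exp_sectorAtInfinity (ha : 0 < a) (hε : 0 < ε) :
    Tendsto (fun κ : ℂ => Complex.exp (-2 * (a : ℂ) * κ)) (sectorAtInfinity ε) (𝓝 0) := by
  obtain ⟨L, hL, hsec⟩ := exists_forall_norm_le_of_mem_sector hε
  have hlim : Tendsto (fun κ : ℂ => Real.exp (-(2 * a / L) * ‖κ‖)) (sectorAtInfinity ε) (𝓝 0) :=
    (Real.tendsto_exp_atBot.comp (tendsto_id.const_mul_atTop_of_neg
      (neg_lt_zero.2 (by positivity)))).comp (tendsto_comap.mono_left inf_le_left)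
  refine squeeze_zero_norm' (eventually_sectorAtInfinity (R := 0) fun κ hl hr _ => ?_) hlim
  rw [Complex.norm_exp, Real.exp_le_exp]
  calc (-2 * (a : ℂ) * κ).re = -(2 * a / L * (L * κ.re)) := by
        rw [← mul_assoc, div_mul_cancel₀ _ hL.ne']
        simp
    _ ≤ -(2 * a / L * ‖κ‖) := by
        gcongr
        exact (hsec κ hl hr).2
    _ = -(2 * a / L) * ‖κ‖ := (neg_mul _ _).symm

theorem isOTilde_of_eventually_le {l : Filter ℂ} {f g : ℂ → ℂ} {C : ℝ} (hg : Tendsto g l (𝓝 0))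
    (hfg : ∀ᶠ κ in l, ‖f κ‖ ≤ C * ‖g κ‖) : IsOTilde l f g := by
  refine ⟨hg, fun δ hδ => ?_⟩
  have hlim : Tendsto (fun κ => |C| * ‖g κ‖ ^ δ) l (𝓝 0) := by
    have hpow := (tendsto_zero_iff_norm_tendsto_zero.1 hg).rpow_const (p := δ) (Or.inr hδ.le)
    rw [Real.zero_rpow hδ.ne'] at hpow
    simpa only [mul_zero] using hpow.const_mul |C|
  refine squeeze_zero_norm' (hfg.mono fun κ hκ => ?_) hlim
  rw [norm_mul, norm_div, Complex.norm_real, Real.norm_of_nonneg (by positivity)]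
  gcongr
  exact div_le_of_le_mul₀ (norm_nonneg _) (abs_nonneg C) (hκ.trans (by gcongr; exact le_abs_self C))

end Sector

section Asymptotics

variable {q : ℝ → ℝ} {e : EndCondition} {z κ : ℂ} {a c ε : ℝ}

theorem exists_weylM_eq (he : e.Admissible q) (hz : 0 < z.im) :
    ∃ p, IsWeylSolution q e z p ∧ weylM q e z = p.2 0 / p.1 0 := by
  have h := exists_isWeylSolution he hz
  exact ⟨h.choose, h.choose_spec, dif_pos h⟩

theorem norm_weylM_sub_le (he : e.Admissible q) (ha : 0 ≤ a) (hac : a < c)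
    (hcb : (c : EReal) < e.endpoint) {L E : ℝ} (hL : 0 < L) (him : ‖κ‖ ≤ L * -κ.im)
    (hre : ‖κ‖ ≤ L * κ.re)
    (hE : E = (1 + 2 * L) * L / (c - a) + 2 * L * ∫ t in (0 : ℝ)..c, |q t|)
    (hκE : 2 * E ≤ ‖κ‖) (hκ : (∫ t in (0 : ℝ)..a, |q t|) + 1 ≤ κ.re) :
    ‖weylM q e (-κ ^ 2) - (-κ - ∫ α in (0 : ℝ)..a,
        (amplitude (truncation q a) α : ℂ) * Complex.exp (-2 * (α : ℂ) * κ))‖ ≤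
      (2 * (4 * E) * Real.exp (4 * E * a) + (∫ t in (0 : ℝ)..a, |q t|) ^ 2 *
        Real.exp ((∫ t in (0 : ℝ)..a, |q t|) * a)) * ‖Complex.exp (-2 * (a : ℂ) * κ)‖ := by
  have hq := he.isIntegrableUpTo
  have hQa : 0 ≤ ∫ t in (0 : ℝ)..a, |q t| :=
    intervalIntegral.integral_nonneg ha fun _ _ => abs_nonneg _
  have hQc : 0 ≤ ∫ t in (0 : ℝ)..c, |q t| :=
    intervalIntegral.integral_nonneg (ha.trans hac.le) fun _ _ => abs_nonneg _
  have hκre : 0 < κ.re := by linarith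
  have hκim : 0 < -κ.im := pos_of_mul_pos_right
    ((hκre.trans_le (Complex.re_le_norm κ)).trans_le him) hL.le
  have hz : 0 < (-κ ^ 2).im := by
    rw [Complex.neg_im, pow_two, Complex.mul_im]
    linarith [mul_pos hκre hκim]
  obtain ⟨p, hp, hm⟩ := exists_weylM_eq he hz
  have hE0 : 0 ≤ E := by
    have := sub_pos.2 hac
    rw [hE]
    positivity
  rw [hm]
  refine hp.1.norm_div_sub_amplitude_le hq hp.2.1 ha (coe_lt_of_le hac.le hcb) (by positivity)
    (fun x hx => ?_) hκ
  subst hE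
  exact hp.1.norm_add_le_mul hq hac hcb
    (fun y hy => hp.flux_nonneg he hz hy.1 (coe_lt_of_le hy.2 hcb)) hL him hre hκE hx

theorem isOTilde_weylM_sub (he : e.Admissible q) (ha : 0 < a) (hab : (a : EReal) < e.endpoint)
    (hε : 0 < ε) :
    IsOTilde (sectorAtInfinity ε)
      (fun κ : ℂ => weylM q e (-κ ^ 2) - (-κ - ∫ α in (0 : ℝ)..a,
        (amplitude (truncation q a) α : ℂ) * Complex.exp (-2 * (α : ℂ) * κ)))
      (fun κ : ℂ => Complex.exp (-2 * (a : ℂ) * κ)) := by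
  obtain ⟨L, hL, hsec⟩ := exists_forall_norm_le_of_mem_sector hε
  obtain ⟨c, hac, hcb⟩ := EReal.lt_iff_exists_real_btwn.1 hab
  exact isOTilde_of_eventually_le (tendsto_exp_sectorAtInfinity ha hε)
    (eventually_sectorAtInfinity (R := max
      (2 * ((1 + 2 * L) * L / (c - a) + 2 * L * ∫ t in (0 : ℝ)..c, |q t|))
      (L * ((∫ t in (0 : ℝ)..a, |q t|) + 1))) fun κ hl hr hR =>
    norm_weylM_sub_le he ha.le (EReal.coe_lt_coe_iff.1 hac) hcb hL (hsec κ hl hr).1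
      (hsec κ hl hr).2 rfl ((le_max_left _ _).trans hR)
      (le_of_mul_le_mul_left (((le_max_right _ _).trans hR).trans (hsec κ hl hr).2) hL))

end Asymptotics

section WeylAmplitude

variable {q : ℝ → ℝ} {b : EReal} {a α : ℝ}

/-- The `A`-function of `q` on all of `[0, b)`. Its value at `α` depends only on `q` on `[0, α]`, so
`q` is cut off there in order to have an integrable potential. -/
noncomputable def weylAmplitude (q : ℝ → ℝ) (α : ℝ) : ℝ :=
  amplitude (truncation q α) α

theorem continuousOn_weylAmplitude_sub_Icc (hq : IsIntegrableUpTo q b) (ha : 0 ≤ a)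
    (hab : (a : EReal) < b) : ContinuousOn (fun α => weylAmplitude q α - q α) (Icc 0 a) := by
  refine (continuous_amplitude_sub (integrable_truncation ha
    (hq.intervalIntegrable ha hab))).continuousOn.congr fun α hα => ?_
  simp only [weylAmplitude, amplitude_truncation hα, truncation_of_mem hα]

theorem continuousOn_weylAmplitude_sub (hq : IsIntegrableUpTo q b) :
    ContinuousOn (fun α => weylAmplitude q α - q α) {α : ℝ | 0 ≤ α ∧ (α : EReal) < b} :=
  continuousOn_of_locally_continuousOn fun α hα => by
    obtain ⟨a, hαa, hab⟩ := EReal.lt_iff_exists_real_btwn.1 hα.2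
    rw [EReal.coe_lt_coe_iff] at hαa
    exact ⟨Iio a, isOpen_Iio, hαa, (continuousOn_weylAmplitude_sub_Icc hq (hα.1.trans hαa.le)
      hab).mono fun x hx => ⟨hx.1.1, le_of_lt hx.2⟩⟩

theorem integrableOn_weylAmplitude (hq : IsIntegrableUpTo q b) (ha : 0 ≤ a)
    (hab : (a : EReal) < b) : IntegrableOn (weylAmplitude q) (Ioo 0 a) := by
  have hqi := (intervalIntegrable_iff_integrableOn_Ioo_of_le ha).1 (hq.intervalIntegrable ha hab)
  have hdiff := (continuousOn_weylAmplitude_sub_Icc hq ha hab).integrableOn_Icc (μ := volume)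
  exact ((hdiff.mono_set Ioo_subset_Icc_self).add hqi).congr (ae_of_all _ fun α =>
    sub_add_cancel _ _)

theorem abs_weylAmplitude_sub_le (hq : IsIntegrableUpTo q b) (hα : 0 ≤ α) (hαb : (α : EReal) < b) :
    |weylAmplitude q α - q α| ≤
      (∫ x in (0 : ℝ)..α, |q x|) ^ 2 * Real.exp (α * ∫ x in (0 : ℝ)..α, |q x|) := by
  have h := abs_amplitude_sub_le (integrable_truncation hα (hq.intervalIntegrable hα hαb)) hα
  rwa [integral_abs_truncation hα, truncation_of_mem ⟨hα, le_rfl⟩] at h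

theorem isOTilde_weylM_sub_weylAmplitude {e : EndCondition} {ε : ℝ} (he : e.Admissible q)
    (ha : 0 < a) (hab : (a : EReal) < e.endpoint) (hε : 0 < ε) :
    IsOTilde (sectorAtInfinity ε)
      (fun κ : ℂ => weylM q e (-κ ^ 2) - (-κ - ∫ α in (0 : ℝ)..a,
        (weylAmplitude q α : ℂ) * Complex.exp (-2 * (α : ℂ) * κ)))
      (fun κ : ℂ => Complex.exp (-2 * (a : ℂ) * κ)) := by
  have hint (κ : ℂ) : ∫ α in (0 : ℝ)..a, (weylAmplitude q α : ℂ) * Complex.exp (-2 * (α : ℂ) * κ) =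
      ∫ α in (0 : ℝ)..a, (amplitude (truncation q a) α : ℂ) * Complex.exp (-2 * (α : ℂ) * κ) :=
    intervalIntegral.integral_congr fun α hα => by
      simp only [weylAmplitude, amplitude_truncation (uIcc_of_le ha.le ▸ hα)]
  simp_rw [hint]
  exact isOTilde_weylM_sub he ha hab hε

end WeylAmplitude

end HalfLine

theorem theorem1p1 (q : ℝ → ℝ) (e : HalfLine.EndCondition) (he : e.Admissible q) :
    ∃ A : ℝ → ℝ,
      (∀ a : ℝ, 0 < a → (a : EReal) < e.endpoint → IntegrableOn A (Ioo 0 a)) ∧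
      (∀ a : ℝ, 0 < a → (a : EReal) < e.endpoint → ∀ ε : ℝ, 0 < ε →
        HalfLine.IsOTilde (HalfLine.sectorAtInfinity ε)
          (fun κ : ℂ => HalfLine.weylM q e (-κ ^ 2) -
            (-κ - ∫ α in (0 : ℝ)..a, (A α : ℂ) * Complex.exp (-2 * (α : ℂ) * κ)))
          (fun κ : ℂ => Complex.exp (-2 * (a : ℂ) * κ))) ∧
      ContinuousOn (fun α => A α - q α) {α : ℝ | 0 ≤ α ∧ (α : EReal) < e.endpoint} ∧
      (∀ α : ℝ, 0 ≤ α → (α : EReal) < e.endpoint →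
        |A α - q α| ≤ (∫ x in (0 : ℝ)..α, |q x|) ^ 2 *
          Real.exp (α * ∫ x in (0 : ℝ)..α, |q x|)) := by
  have hq := he.isIntegrableUpTo
  exact ⟨HalfLine.weylAmplitude q,
    fun _ ha hab => HalfLine.integrableOn_weylAmplitude hq ha.le hab,
    fun _ ha hab _ hε => HalfLine.isOTilde_weylM_sub_weylAmplitude he ha hab hε,
    HalfLine.continuousOn_weylAmplitude_sub hq,
    fun _ hα hαb => HalfLine.abs_weylAmplitude_sub_le hq hα hαb⟩
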